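/- Let $p$ be fixed and $\beta^0\in\mathbb{R}^p$. Let $X_1,X_2,\dots$ be i.i.d. centered random vectors in $\mathbb{R}^p$ with finite second moments and positive definite covariance matrix $C$, let $\varepsilon_1,\varepsilon_2,\dots$ be i.i.d. centered real random variables with variance $\sigma^2\in(0,\infty)$, and let the sequences $(X_i)$ and $(\varepsilon_i)$ be independent. Put $y_i=X_i^T\beta^0+\varepsilon_i$. For $\lambda\in\mathbb{R}^p$ with $\lambda_1\ge\dots\ge\lambda_p\ge 0$ let $J_\lambda(\beta)=\sum_{i=1}^p\lambda_i|\beta|_{(i)}$, where $|\beta|_{(1)}\ge\dots\ge|\beta|_{(p)}$ are the ordered absolute values of the coordinates of $\beta$, and let $J'_\lambda(\beta^0;u)=\lim_{t\searrow0}\bigl(J_\lambda(\beta^0+tu)-J_\lambda(\beta^0)\bigr)/t$. Let $\lambda^n$ be (deterministic) vectors with $\lambda^n_1\ge\dots\ge\lambda^n_p\ge0$ and $\lambda^n/\sqrt n\to\lambda$. For each $n$ let the SLOPE estimator $\hat\beta_n$ be a random vector with, almost surely, $$\hat\beta_n\in\operatorname*{argmin}_{\beta\in\mathbb{R}^p}\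 \tfrac12\sum_{i=1}^n(y_i-X_i^T\beta)^2+J_{\lambda^n}(\beta),$$ and let $$\hat u=\operatorname*{argmin}_{u\in\mathbb{R}^p}\ \tfrac12u^TCu-u^TW+J'_\lambda(\beta^0;u),\qquad W\sim\mathcal{N}(0,\sigma^2C).$$ The pattern $\mathbf{patt}(u)\in\mathbb{Z}^p$ of $u\in\mathbb{R}^p$ is $\mathbf{patt}(u)_i=\operatorname{rank}(|u_i|)\operatorname{sgn}(u_i)$, where $\operatorname{rank}(|u_i|)$ is the number of distinct values $t$ among $|u_1|,\dots,|u_p|$ with $0<t\le|u_i|$, and the limiting pattern of $u$ with respect to $\beta^0$ is $\mathbf{patt}_{\beta^0}(u)=\lim_{\epsilon\searrow0}\mathbf{patt}(\beta^0+\epsilon u)$. Then for every pattern $\mathfrak{p}\in\{\mathbf{patt}(u):u\in\mathbb{R}^p\}$, $$\mathbb{P}[\mathbf{patt}(\hat\beta_n)=\mathfrak{p}]\xrightarrow[n\to\infty]{}\mathbb{P}[\mathbf{patt}_{\beta^0}(\hat u)=\mathfrak{p}].$$ That is, the pattern of the SLOPE estimator is asymptotically distributed as the limiting pattern of $\hat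 u$ with respect to $\beta^0$. -/

import Mathlib

open MeasureTheory ProbabilityTheory Filter Topology

namespace SLOPE

/-- The `i`-th largest absolute value `|b|_(i)` of the coordinates of `b` (indices from `0`). -/
noncomputable def sortedAbs {p : ℕ} (b : EuclideanSpace ℝ (Fin p)) (i : Fin p) : ℝ :=
  |b (Tuple.sort (fun j => -|b j|) i)|

/-- The SLOPE norm `J_lam(b) = ∑ i, lam i * |b|_(i)`. -/
noncomputable def J {p : ℕ} (lam : Fin p → ℝ) (b : EuclideanSpace ℝ (Fin p)) : ℝ :=
  ∑ i, lam i * sortedAbs b i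

/-- The (one-sided) directional derivative `J'_lam(b; u)` of the SLOPE norm at `b` in direction
`u`; the limit exists by `tendsto_dirDeriv`. -/
noncomputable def dirDeriv {p : ℕ} (lam : Fin p → ℝ) (b u : EuclideanSpace ℝ (Fin p)) : ℝ :=
  limUnder (𝓝[>] (0 : ℝ)) fun t : ℝ => (J lam (b + t • u) - J lam b) / t

/-- Rank of `|u i|` among the distinct values of `|u|`: zero has rank `0`, and the nonzero values
have ranks `1, 2, …` in increasing order. -/
noncomputable def rank {p : ℕ} (u : EuclideanSpace ℝ (Fin p)) (i : Fin p) : ℕ :=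
  {t : ℝ | 0 < t ∧ t ≤ |u i| ∧ ∃ j, |u j| = t}.ncard

/-- The SLOPE pattern `patt(u)_i = rank(|u_i|) * sgn(u_i)`. -/
noncomputable def patt {p : ℕ} (u : EuclideanSpace ℝ (Fin p)) : Fin p → ℤ :=
  fun i => (rank u i : ℤ) * (SignType.sign (u i) : ℤ)

/-- The limiting pattern of `u` with respect to `b`: the limit of `patt (b + ε u)` as `ε ↘ 0`;
the limit exists (the pattern is eventually constant) by `eventually_patt_eq`. -/
noncomputable def limitPatt {p : ℕ} (b u : EuclideanSpace ℝ (Fin p)) : Fin p → ℤ :=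
  limUnder (𝓝[>] (0 : ℝ)) fun ε : ℝ => patt (b + ε • u)

/-- The least squares SLOPE objective
`½ ∑_{i < n} (y i - ⟨x i, b⟩)² + J_lam(b)` for the first `n` observations. -/
noncomputable def objective {p : ℕ} (n : ℕ) (x : ℕ → EuclideanSpace ℝ (Fin p)) (y : ℕ → ℝ)
    (lam : Fin p → ℝ) (b : EuclideanSpace ℝ (Fin p)) : ℝ :=
  (1 / 2) * ∑ i ∈ Finset.range n, (y i - inner ℝ (x i) b) ^ 2 + J lam b

/-- The limiting objective `V(u) = ½ uᵀ C u - uᵀ w + J'_lam(b; u)`. -/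
noncomputable def limitObjective {p : ℕ} (C : Matrix (Fin p) (Fin p) ℝ) (lam : Fin p → ℝ)
    (b w u : EuclideanSpace ℝ (Fin p)) : ℝ :=
  (1 / 2) * (u.ofLp ⬝ᵥ C.mulVec u.ofLp) - u.ofLp ⬝ᵥ w.ofLp + dirDeriv lam b u

/-! Well-definedness of the two limits above. -/

theorem sign_linear_eventually (a c : ℝ) :
    ∃ s : SignType, ∀ᶠ t in 𝓝[>] (0 : ℝ), SignType.sign (a + t * c) = s := by
  have hc : Tendsto (fun t : ℝ => a + t * c) (𝓝[>] 0) (𝓝 a) := by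
    have : Tendsto (fun t : ℝ => a + t * c) (𝓝 0) (𝓝 (a + 0 * c)) :=
      Continuous.tendsto (by fun_prop) 0
    simpa using this.mono_left nhdsWithin_le_nhds
  rcases lt_trichotomy a 0 with h | h | h
  · refine ⟨-1, ?_⟩
    filter_upwards [hc.eventually_lt_const h] with t ht using sign_neg ht
  · refine ⟨SignType.sign c, ?_⟩
    filter_upwards [self_mem_nhdsWithin] with t ht
    rw [h, zero_add, sign_mul, sign_pos ht, one_mul]
  · refine ⟨1, ?_⟩
    filter_upwards [hc.eventually_const_lt h] with t ht using sign_pos ht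

theorem abs_linear_eventually (a c : ℝ) :
    ∃ a' c' : ℝ, |a| = a' ∧ ∀ᶠ t in 𝓝[>] (0 : ℝ), |a + t * c| = a' + t * c' := by
  obtain ⟨s, hs⟩ := sign_linear_eventually a c
  have key : ∀ᶠ t in 𝓝[>] (0 : ℝ), |a + t * c| = (s : ℝ) * a + t * ((s : ℝ) * c) := by
    filter_upwards [hs] with t ht
    rw [← sign_mul_self (a + t * c), ht]; ring
  refine ⟨(s : ℝ) * a, (s : ℝ) * c, ?_, key⟩
  have h1 : Tendsto (fun t : ℝ => |a + t * c|) (𝓝[>] 0) (𝓝 |a + 0 * c|) :=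
    (Continuous.tendsto (by fun_prop) 0).mono_left nhdsWithin_le_nhds
  have h2 : Tendsto (fun t : ℝ => (s : ℝ) * a + t * ((s : ℝ) * c)) (𝓝[>] 0)
      (𝓝 ((s : ℝ) * a + 0 * ((s : ℝ) * c))) :=
    (Continuous.tendsto (by fun_prop) 0).mono_left nhdsWithin_le_nhds
  simpa using tendsto_nhds_unique (h1.congr' key) h2

/-- For small `ε > 0` the signs and the comparisons of the absolute values of the coordinates of
`b + ε u` do not depend on `ε`. -/
theorem eventually_signs {p : ℕ} (b u : EuclideanSpace ℝ (Fin p)) :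
    ∃ (s : Fin p → SignType) (r : Fin p → Fin p → SignType), ∀ᶠ ε in 𝓝[>] (0 : ℝ),
      (∀ i, SignType.sign ((b + ε • u) i) = s i) ∧
      ∀ i j, SignType.sign (|(b + ε • u) i| - |(b + ε • u) j|) = r i j := by
  choose s hs using fun i => sign_linear_eventually (b i) (u i)
  choose a' c' ha hc using fun i => abs_linear_eventually (b i) (u i)
  choose r hr using fun i j => sign_linear_eventually (a' i - a' j) (c' i - c' j)
  refine ⟨s, r, ?_⟩
  filter_upwards [eventually_all.2 hs, eventually_all.2 hc,
    eventually_all.2 fun i => eventually_all.2 (hr i)] with t h1 h2 h3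
  refine ⟨fun i => by simpa using h1 i, fun i j => ?_⟩
  rw [← h3 i j]
  simp only [PiLp.add_apply, PiLp.smul_apply, smul_eq_mul, h2]
  congr 1; ring

theorem le_iff_of_sign {a b c d : ℝ} (h : SignType.sign (a - b) = SignType.sign (c - d)) :
    a ≤ b ↔ c ≤ d := by
  rw [← sub_nonpos, ← sub_nonpos (a := c), ← sign_nonpos_iff, h, sign_nonpos_iff]

theorem ncard_congr_of_le {p : ℕ} {f g : Fin p → ℝ} (h : ∀ i j, f i ≤ f j ↔ g i ≤ g j)
    (h0 : ∀ i, 0 < f i ↔ 0 < g i) (i : Fin p) :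
    {t : ℝ | 0 < t ∧ t ≤ f i ∧ ∃ j, f j = t}.ncard =
      {t : ℝ | 0 < t ∧ t ≤ g i ∧ ∃ j, g j = t}.ncard := by
  have himg : ∀ q : Fin p → ℝ, {t : ℝ | 0 < t ∧ t ≤ q i ∧ ∃ j, q j = t} =
      q '' {j | 0 < q j ∧ q j ≤ q i} := by
    intro q; ext t; constructor
    · rintro ⟨h1, h2, j, rfl⟩; exact ⟨j, ⟨h1, h2⟩, rfl⟩
    · rintro ⟨j, ⟨h1, h2⟩, rfl⟩; exact ⟨h1, h2, j, rfl⟩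
  have hE : ∀ j k, f j = f k ↔ g j = g k := fun j k => by
    rw [le_antisymm_iff, le_antisymm_iff, h, h]
  have hF : ∀ t (ht : t ∈ f '' {j | 0 < f j ∧ f j ≤ f i}),
      f ht.choose = t := fun t ht => ht.choose_spec.2
  rw [himg f, himg g]
  refine Set.ncard_congr (fun t ht => g ht.choose) ?_ ?_ ?_
  · intro t ht
    have := ht.choose_spec.1
    exact ⟨_, ⟨(h0 _).1 this.1, (h _ _).1 this.2⟩, rfl⟩
  · intro t t' ht ht' he
    rw [← hF t ht, ← hF t' ht']; exact (hE _ _).2 he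
  · rintro _ ⟨j, ⟨h1, h2⟩, rfl⟩
    have hm : f j ∈ f '' {j | 0 < f j ∧ f j ≤ f i} := ⟨j, ⟨(h0 _).2 h1, (h _ _).2 h2⟩, rfl⟩
    exact ⟨f j, hm, (hE _ _).1 (hF _ hm)⟩

theorem patt_congr {p : ℕ} {x y : EuclideanSpace ℝ (Fin p)}
    (h1 : ∀ i, SignType.sign (x i) = SignType.sign (y i))
    (h2 : ∀ i j, SignType.sign (|x i| - |x j|) = SignType.sign (|y i| - |y j|)) :
    patt x = patt y := by
  funext i
  have : rank x i = rank y i := by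
    refine ncard_congr_of_le (f := fun i => |x i|) (g := fun i => |y i|)
      (fun i j => le_iff_of_sign (h2 i j)) (fun i => ?_) i
    simp only [abs_pos]
    rw [← sign_ne_zero, h1, sign_ne_zero]
  simp only [patt, this, h1 i]

/-- The pattern of `b + ε u` is eventually constant, equal to `limitPatt b u`, as `ε ↘ 0`. -/
theorem eventually_patt_eq {p : ℕ} (b u : EuclideanSpace ℝ (Fin p)) :
    ∀ᶠ ε in 𝓝[>] (0 : ℝ), patt (b + ε • u) = limitPatt b u := by
  obtain ⟨s, r, h⟩ := eventually_signs b u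
  obtain ⟨ε₀, h₀⟩ := h.exists
  have hc : ∀ᶠ ε in 𝓝[>] (0 : ℝ), patt (b + ε • u) = patt (b + ε₀ • u) := by
    filter_upwards [h] with ε hε
    exact patt_congr (fun i => by rw [hε.1, h₀.1]) (fun i j => by rw [hε.2, h₀.2])
  have hl : limitPatt b u = patt (b + ε₀ • u) :=
    (tendsto_const_nhds.congr' (hc.mono fun _ h => h.symm)).limUnder_eq
  rw [hl]; exact hc

/-- The difference quotients defining `dirDeriv` converge. -/
theorem tendsto_dirDeriv {p : ℕ} (lam : Fin p → ℝ) (b u : EuclideanSpace ℝ (Fin p)) :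
    Tendsto (fun t : ℝ => (J lam (b + t • u) - J lam b) / t) (𝓝[>] 0)
      (𝓝 (dirDeriv lam b u)) := by
  obtain ⟨s, r, h⟩ := eventually_signs b u
  obtain ⟨ε₀, h₀⟩ := h.exists
  choose a' c' ha hc using fun i => abs_linear_eventually (b i) (u i)
  set σ := Tuple.sort (fun j => -|(b + ε₀ • u) j|) with hσ
  have hσ' := Tuple.eq_sort_iff.1 hσ
  have hsort : ∀ᶠ t in 𝓝[>] (0 : ℝ), Tuple.sort (fun j => -|(b + t • u) j|) = σ := by
    filter_upwards [h] with t ht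
    have hle : ∀ i j, -|(b + t • u) i| ≤ -|(b + t • u) j| ↔
        -|(b + ε₀ • u) i| ≤ -|(b + ε₀ • u) j| := fun i j => by
      rw [neg_le_neg_iff, neg_le_neg_iff]
      exact le_iff_of_sign (by rw [ht.2, h₀.2])
    refine (Tuple.eq_sort_iff.2 ⟨fun i j hij => (hle _ _).2 (hσ'.1 hij), fun i j hij he => ?_⟩).symm
    refine hσ'.2 i j hij (le_antisymm ((hle _ _).1 he.le) ((hle _ _).1 he.ge))
  have hmono : Monotone ((fun j => -|b j|) ∘ σ) := by
    intro i j hij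
    have hl : ∀ k, Tendsto (fun t : ℝ => -|(b + t • u) k|) (𝓝[>] 0) (𝓝 (-|b k|)) := fun k => by
      have : Tendsto (fun t : ℝ => -|b k + t * u k|) (𝓝[>] 0) (𝓝 (-|b k + 0 * u k|)) :=
        (Continuous.tendsto (by fun_prop) 0).mono_left nhdsWithin_le_nhds
      simpa using this
    refine le_of_tendsto_of_tendsto (hl (σ i)) (hl (σ j)) ?_
    filter_upwards [hsort] with t ht
    have := Tuple.monotone_sort (fun j => -|(b + t • u) j|) hij
    rwa [ht] at this
  have hb : ∀ i, sortedAbs b i = a' (σ i) := fun i => by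
    have := congrFun (Tuple.comp_sort_eq_comp_iff_monotone.2 hmono) i
    simp only [Function.comp_apply, neg_inj] at this
    rw [sortedAbs, ← ha, this]
  have hq : ∀ᶠ t in 𝓝[>] (0 : ℝ),
      (J lam (b + t • u) - J lam b) / t = ∑ i, lam i * c' (σ i) := by
    filter_upwards [hsort, eventually_all.2 hc, self_mem_nhdsWithin] with t h1 h2 h3
    have ht : t ≠ 0 := ne_of_gt h3
    rw [div_eq_iff ht, J, J, ← Finset.sum_sub_distrib, Finset.sum_mul]
    refine Finset.sum_congr rfl fun i _ => ?_
    rw [hb, sortedAbs, h1]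
    simp only [PiLp.add_apply, PiLp.smul_apply, smul_eq_mul, h2]
    ring
  have ht := (tendsto_const_nhds (x := ∑ i, lam i * c' (σ i))).congr'
    (hq.mono fun _ h => h.symm)
  exact tendsto_nhds_limUnder ⟨_, ht⟩

end SLOPE

namespace SLOPE

/-! Convergence in law of `√n (βhat - β₀)` does not give convergence of patterns, because `patt` is
discontinuous. The proof instead shows that the optimality conditions for a fixed pattern are stable
under perturbation of the data, and then uses the portmanteau theorem on open sets of data.

After rescaling, the problem depends on `β₀` and on the data `Z n = (empCov, score, lam n / √n, 1 /
√n)`. By the strong law, the central limit theorem and Slutsky, `Z n` converges in law to `(A, W,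
lam₀, 0)`, with `A` the operator of `C`.

The SLOPE norm is a maximum of linear functionals indexed by permutations and signs. Hence its dual
ball is cut out by the finitely many sign vectors (`inner_le_J_of_signVec`), and on the span `T` of
a pattern the optimality conditions become a linear equation. At the limiting data, `W - A uhat` is
a subgradient of `J` at `β₀ + t uhat` for small `t > 0`. If it meets the constraints of all sign
vectors outside `T` strictly, solving the equation in `T` for nearby data gives a point with the
same signs, and the strict inequalities persist (`patternSolvable_mem_nhds`). Equality in one of
these constraints forces `W` into a fixed hyperplane (`degenerateSet_subset_hyperplane`), which is a
null event for a nondegenerate Gaussian.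

So almost surely the limiting data lie in the interior of the set where the limiting pattern is
solvable, and data in that set force the pattern of the estimator (`patt_eq_of_patternSolvable`).
Applying the open-set bound to a pattern and to its complement gives both halves of the limit. -/

variable {p : ℕ}

/-! ### The SLOPE norm as a maximum of linear functionals, and its dual ball. -/

/-- The vector with entries `mu` placed in the order `π` and multiplied by the signs `s`. -/
noncomputable def arrange (π : Equiv.Perm (Fin p)) (s : Fin p → SignType) (mu : Fin p → ℝ) :
    EuclideanSpace ℝ (Fin p) :=
  WithLp.toLp 2 fun j => mu (π.symm j) * (s j : ℝ)

/-- `s` is a sign vector of `b` and `π` sorts the absolute values of `b` in decreasing order. -/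
structure Sorts (π : Equiv.Perm (Fin p)) (s : Fin p → SignType)
    (b : EuclideanSpace ℝ (Fin p)) : Prop where
  sign_mul : ∀ i, (s i : ℝ) * b i = |b i|
  antitone : Antitone fun k => |b (π k)|

/-- The vector with entries the signs `s`. -/
noncomputable def signVec (s : Fin p → SignType) : EuclideanSpace ℝ (Fin p) :=
  WithLp.toLp 2 fun j => (s j : ℝ)

theorem inner_arrange (π : Equiv.Perm (Fin p)) (s : Fin p → SignType) (mu : Fin p → ℝ)
    (v : EuclideanSpace ℝ (Fin p)) :
    inner ℝ (arrange π s mu) v = ∑ k, mu k * ((s (π k) : ℝ) * v (π k)) := by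
  rw [PiLp.inner_apply, ← Equiv.sum_comp π]
  refine Finset.sum_congr rfl fun k _ => ?_
  simp [arrange]; ring

theorem continuous_arrange (π : Equiv.Perm (Fin p)) (s : Fin p → SignType) :
    Continuous (arrange π s) := by
  unfold arrange
  fun_prop

theorem antitone_sortedAbs (b : EuclideanSpace ℝ (Fin p)) : Antitone (sortedAbs b) := by
  intro i j hij
  have := Tuple.monotone_sort (fun j => -|b j|) hij
  simpa [sortedAbs] using this

theorem sorts_sort (b : EuclideanSpace ℝ (Fin p)) :
    Sorts (Tuple.sort fun j => -|b j|) (fun i => SignType.sign (b i)) b :=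
  ⟨fun i => sign_mul_self (b i), antitone_sortedAbs b⟩

/-- Ties and zeros leave freedom in `π` and `s`, and any admissible choice works. Vectors that share
one choice therefore lie in a common cone on which `J` is linear. -/
theorem Sorts.J_eq {π : Equiv.Perm (Fin p)} {s : Fin p → SignType}
    {b : EuclideanSpace ℝ (Fin p)} (h : Sorts π s b) (mu : Fin p → ℝ) :
    J mu b = inner ℝ (arrange π s mu) b := by
  rw [inner_arrange, J]
  refine Finset.sum_congr rfl fun k _ => ?_
  have hmono : Monotone ((fun j => -|b j|) ∘ π) := fun i j hij => neg_le_neg (h.antitone hij)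
  have := congrFun (Tuple.comp_sort_eq_comp_iff_monotone.2 hmono) k
  simp only [Function.comp_apply, neg_inj] at this
  rw [h.sign_mul, sortedAbs, this]

/-- Rearrangement inequality: pairing the decreasing weights with the decreasing absolute values
maximizes the sum. With `Sorts.J_eq` this exhibits `J` as a support function, whence its convexity.
-/
theorem inner_arrange_le {mu : Fin p → ℝ} (ha : Antitone mu) (h0 : ∀ i, 0 ≤ mu i)
    (π : Equiv.Perm (Fin p)) (s : Fin p → SignType) (v : EuclideanSpace ℝ (Fin p)) :
    inner ℝ (arrange π s mu) v ≤ J mu v := by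
  rw [inner_arrange]
  have h1 : ∀ k, mu k * ((s (π k) : ℝ) * v (π k)) ≤ mu k * |v (π k)| := fun k => by
    refine mul_le_mul_of_nonneg_left ?_ (h0 k)
    rcases s (π k) with _ | _ | _
    · simp
    · simpa using neg_le_abs _
    · simpa using le_abs_self _
  refine (Finset.sum_le_sum fun k _ => h1 k).trans ?_
  set ρ := Tuple.sort fun j => -|v j|
  have hm : Monovary mu (sortedAbs v) := ha.monovary (antitone_sortedAbs v)
  have := hm.sum_mul_comp_perm_le_sum_mul (σ := π.trans ρ.symm)
  refine le_trans (le_of_eq ?_) this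
  refine Finset.sum_congr rfl fun k _ => ?_
  simp [sortedAbs, ρ]

theorem Sorts.smul {π : Equiv.Perm (Fin p)} {s : Fin p → SignType}
    {b : EuclideanSpace ℝ (Fin p)} (h : Sorts π s b) {c : ℝ} (hc : 0 ≤ c) :
    Sorts π s (c • b) where
  sign_mul i := by
    have := h.sign_mul i
    simp only [PiLp.smul_apply, smul_eq_mul, abs_mul, abs_of_nonneg hc, ← this]; ring
  antitone i j hij := by
    have := h.antitone hij
    simp only [PiLp.smul_apply, smul_eq_mul, abs_mul, abs_of_nonneg hc]
    exact mul_le_mul_of_nonneg_left this hc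

theorem J_smul (mu : Fin p → ℝ) (b : EuclideanSpace ℝ (Fin p)) {c : ℝ} (hc : 0 ≤ c) :
    J mu (c • b) = c * J mu b := by
  rw [(sorts_sort b).J_eq, ((sorts_sort b).smul hc).J_eq, inner_smul_right]

theorem J_smul_left (c : ℝ) (mu : Fin p → ℝ) (b : EuclideanSpace ℝ (Fin p)) :
    J (c • mu) b = c * J mu b := by
  simp only [J, Pi.smul_apply, smul_eq_mul, Finset.mul_sum, mul_assoc]

theorem J_zero (mu : Fin p → ℝ) : J mu 0 = 0 := by
  simpa using J_smul mu 0 le_rfl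

theorem J_add_le {mu : Fin p → ℝ} (ha : Antitone mu) (h0 : ∀ i, 0 ≤ mu i)
    (x y : EuclideanSpace ℝ (Fin p)) : J mu (x + y) ≤ J mu x + J mu y := by
  rw [(sorts_sort (x + y)).J_eq, inner_add_right]
  exact add_le_add (inner_arrange_le ha h0 _ _ _) (inner_arrange_le ha h0 _ _ _)

theorem continuous_J_left (b : EuclideanSpace ℝ (Fin p)) : Continuous fun mu => J mu b := by
  unfold J
  fun_prop

/-- The dual unit ball of the SLOPE norm is cut out by the finitely many sign vectors. -/
theorem inner_le_J_of_signVec {mu : Fin p → ℝ} {f : EuclideanSpace ℝ (Fin p)}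
    (h : ∀ s, inner ℝ f (signVec s) ≤ J mu (signVec s)) (z : EuclideanSpace ℝ (Fin p)) :
    inner ℝ f z ≤ J mu z := by
  induction hn : (Finset.univ.filter fun i => z i ≠ 0).card using Nat.strong_induction_on
    generalizing z with
  | _ n ih =>
  by_cases hz : (Finset.univ.filter fun i => z i ≠ 0).Nonempty
  swap
  · have : z = 0 := by
      ext i
      by_contra hi
      exact hz ⟨i, by simpa using hi⟩
    simp [this, J_zero]
  obtain ⟨k, hk, hmin⟩ := Finset.exists_min_image _ (fun i => |z i|) hz
  simp only [Finset.mem_filter, Finset.mem_univ, true_and] at hk hmin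
  set m := |z k| with hm
  have hm0 : 0 < m := abs_pos.2 hk
  set s : Fin p → SignType := fun i => SignType.sign (z i) with hs
  set π := Tuple.sort fun j => -|z j|
  have hsz : Sorts π s z := sorts_sort z
  have hssq : ∀ i, (s i : ℝ) * (s i : ℝ) = if z i = 0 then 0 else 1 := fun i => by
    rcases lt_trichotomy (z i) 0 with h | h | h
    · simp [hs, sign_neg h, h.ne]
    · simp [hs, h]
    · simp [hs, sign_pos h, h.ne']
  -- Since `m` is the smallest nonzero absolute value, the subtraction kills at least the coordinate
  -- `k`, reverses no sign and keeps the order of the absolute values. The induction is on the size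
  -- of the support.
  set z' := z - m • signVec s with hz'
  have hz'i : ∀ i, z' i = z i - m * (s i : ℝ) := fun i => by simp [hz', signVec]
  have habs1 : ∀ i, |signVec s i| = if z i = 0 then 0 else 1 := fun i => by
    rw [← abs_of_nonneg (a := (if z i = 0 then 0 else 1 : ℝ)) (by split_ifs <;> simp), ← hssq]
    rcases h : s i with _ | _ | _ <;> simp [signVec, h]
  have hge : ∀ i, 0 ≤ |z i| - m * (if z i = 0 then 0 else 1) := fun i => by
    split_ifs with h
    · simp
    · simpa using hmin i h
  have hsz' : ∀ i, (s i : ℝ) * z' i = |z i| - m * (if z i = 0 then 0 else 1) := fun i => by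
    rw [hz'i, ← hsz.sign_mul, ← hssq]; ring
  have habs2 : ∀ i, |z' i| = |z i| - m * (if z i = 0 then 0 else 1) := fun i => by
    by_cases h : z i = 0
    · have : s i = 0 := by simp [hs, h]
      simp [hz'i, h, this]
    · rw [← hsz', ← abs_of_nonneg (a := (s i : ℝ) * z' i) (by rw [hsz']; exact hge i), abs_mul]
      have := habs1 i
      simp only [signVec, h, if_false] at this
      rw [this, one_mul]
  have hanti := hsz.antitone
  have h1 : Sorts π s (signVec s) := by
    refine ⟨fun i => ?_, fun i j hij => ?_⟩
    · rw [habs1, ← hssq]; rfl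
    · simp only [habs1]
      by_cases hj : z (π j) = 0
      · split_ifs <;> norm_num
      · have hi : z (π i) ≠ 0 := fun hi => hj (abs_nonpos_iff.1 ((hanti hij).trans (by simp [hi])))
        simp [hi, hj]
  have h2 : Sorts π s z' := by
    refine ⟨fun i => by rw [hsz', habs2], fun i j hij => ?_⟩
    have := hanti hij
    simp only at this
    simp only [habs2]
    by_cases hj : z (π j) = 0
    · simpa [hj] using hge (π i)
    · have hi : z (π i) ≠ 0 := fun hi => hj (abs_nonpos_iff.1 (this.trans (by simp [hi])))
      simpa [hi, hj] using this
  have hcard : (Finset.univ.filter fun i => z' i ≠ 0).card < n := by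
    rw [← hn]
    refine Finset.card_lt_card ⟨fun i hi => ?_, fun hsub => ?_⟩
    · simp only [Finset.mem_filter, Finset.mem_univ, true_and] at hi ⊢
      intro h
      apply hi
      rw [← abs_eq_zero, habs2]; simp [h]
    · have : k ∈ Finset.univ.filter fun i => z' i ≠ 0 := hsub (by simpa using hk)
      simp only [Finset.mem_filter, Finset.mem_univ, true_and] at this
      apply this
      rw [← abs_eq_zero, habs2]; simp [hk, hm]
  have hdec : z = m • signVec s + z' := by rw [hz']; abel
  -- The same `π` and `s` sort all three vectors, so `J` is additive here.
  have hJ : J mu z = m * J mu (signVec s) + J mu z' := by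
    rw [hsz.J_eq, h1.J_eq, h2.J_eq, ← inner_smul_right, ← inner_add_right, ← hdec]
  calc inner ℝ f z = m * inner ℝ f (signVec s) + inner ℝ f z' := by
        rw [← inner_smul_right, ← inner_add_right, ← hdec]
    _ ≤ m * J mu (signVec s) + J mu z' :=
        add_le_add (mul_le_mul_of_nonneg_left (h s) hm0.le) (ih _ hcard z' rfl)
    _ = J mu z := hJ.symm

/-! ### Pattern spaces and stability of signs. -/

/-- The linear space of vectors that vanish where `s` does and whose absolute values agree,
with signs `s`, on the pairs where `r` vanishes. -/
def patternSpace (s : Fin p → SignType) (r : Fin p → Fin p → SignType) :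
    Submodule ℝ (EuclideanSpace ℝ (Fin p)) where
  carrier := {v | (∀ i, s i = 0 → v i = 0) ∧
    ∀ i j, r i j = 0 → (s i : ℝ) * v i = (s j : ℝ) * v j}
  add_mem' := by
    rintro a b ⟨h1, h2⟩ ⟨h3, h4⟩
    refine ⟨fun i hi => by simp [h1 i hi, h3 i hi], fun i j hij => ?_⟩
    simp [mul_add, h2 i j hij, h4 i j hij]
  zero_mem' := by simp
  smul_mem' := by
    rintro c a ⟨h1, h2⟩
    refine ⟨fun i hi => by simp [h1 i hi], fun i j hij => ?_⟩
    have := h2 i j hij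
    simp only [PiLp.smul_apply, smul_eq_mul]
    linear_combination c * this

/-- `s` and `r` are the signs of the coordinates of `b` and of the comparisons of their absolute
values. -/
def HasSigns (s : Fin p → SignType) (r : Fin p → Fin p → SignType)
    (b : EuclideanSpace ℝ (Fin p)) : Prop :=
  (∀ i, SignType.sign (b i) = s i) ∧ ∀ i j, SignType.sign (|b i| - |b j|) = r i j

theorem HasSigns.mem {s : Fin p → SignType} {r : Fin p → Fin p → SignType}
    {b : EuclideanSpace ℝ (Fin p)} (h : HasSigns s r b) : b ∈ patternSpace s r := by
  refine ⟨fun i hi => by rwa [← h.1, sign_eq_zero_iff] at hi, fun i j hij => ?_⟩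
  rw [← h.2, sign_eq_zero_iff, sub_eq_zero] at hij
  rwa [← h.1, ← h.1, sign_mul_self, sign_mul_self]

theorem HasSigns.sorts {s : Fin p → SignType} {r : Fin p → Fin p → SignType}
    {b b' : EuclideanSpace ℝ (Fin p)} (h : HasSigns s r b) (h' : HasSigns s r b') :
    Sorts (Tuple.sort fun j => -|b j|) s b' := by
  refine ⟨fun i => by rw [← h'.1, sign_mul_self], fun i j hij => ?_⟩
  have hle : ∀ k l, |b k| ≤ |b l| → |b' k| ≤ |b' l| := fun k l =>
    (le_iff_of_sign (by rw [h.2, h'.2])).1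
  exact hle _ _ (antitone_sortedAbs b hij)

theorem HasSigns.patt_eq {s : Fin p → SignType} {r : Fin p → Fin p → SignType}
    {b b' : EuclideanSpace ℝ (Fin p)} (h : HasSigns s r b) (h' : HasSigns s r b') :
    patt b = patt b' :=
  patt_congr (fun i => by rw [h.1, h'.1]) fun i j => by rw [h.2, h'.2]

/-- If `a ≠ 0` the sign is that of `a`; if `a = 0` it is that of the slope, which is stable unless
`c = 0`. Only that last case needs the side condition, which membership in the pattern space will
supply. -/
theorem eventually_sign_perturb {a c : ℝ} {σ : SignType}
    (h : ∀ᶠ t in 𝓝[>] (0 : ℝ), SignType.sign (a + t * c) = σ) :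
    ∀ᶠ q in 𝓝[>] (0 : ℝ) ×ˢ 𝓝 c, (σ = 0 → a + q.1 * q.2 = 0) →
      SignType.sign (a + q.1 * q.2) = σ := by
  have hlim : Tendsto (fun q : ℝ × ℝ => a + q.1 * q.2) (𝓝[>] (0 : ℝ) ×ˢ 𝓝 c) (𝓝 a) := by
    have : Tendsto (fun q : ℝ × ℝ => a + q.1 * q.2) (𝓝 0 ×ˢ 𝓝 c) (𝓝 (a + 0 * c)) := by
      rw [← nhds_prod_eq]
      exact Continuous.tendsto (f := fun q : ℝ × ℝ => a + q.1 * q.2) (by fun_prop) (0, c)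
    simpa using this.mono_left (prod_mono nhdsWithin_le_nhds le_rfl)
  have hlim' : Tendsto (fun t : ℝ => a + t * c) (𝓝[>] 0) (𝓝 a) := by
    have : Tendsto (fun t : ℝ => a + t * c) (𝓝 0) (𝓝 (a + 0 * c)) :=
      Continuous.tendsto (by fun_prop) 0
    simpa using this.mono_left nhdsWithin_le_nhds
  have hpos : ∀ᶠ q in 𝓝[>] (0 : ℝ) ×ˢ 𝓝 c, 0 < q.1 :=
    (eventually_mem_nhdsWithin (a := (0 : ℝ)) (s := Set.Ioi 0)).prod_inl _
  rcases lt_trichotomy a 0 with ha | ha | ha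
  · obtain ⟨t, h1, h2⟩ := (h.and (hlim'.eventually_lt_const ha)).exists
    filter_upwards [hlim.eventually_lt_const ha] with q hq _
    rw [← h1, sign_neg hq, sign_neg h2]
  · subst ha
    obtain ⟨t, h1, ht⟩ := (h.and (eventually_mem_nhdsWithin (a := (0 : ℝ)) (s := Set.Ioi 0))).exists
    rw [zero_add, sign_mul, sign_pos ht, one_mul] at h1
    rcases lt_trichotomy c 0 with hc | hc | hc
    · filter_upwards [hpos, (eventually_lt_nhds hc).prod_inr (𝓝[>] (0 : ℝ))] with q h2 h3 _
      rw [zero_add, sign_mul, sign_pos h2, one_mul, sign_neg h3, ← h1, sign_neg hc]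
    · refine Eventually.of_forall fun q hq => ?_
      rw [hq (by simp [← h1, hc]), ← h1]; simp [hc]
    · filter_upwards [hpos, (eventually_gt_nhds hc).prod_inr (𝓝[>] (0 : ℝ))] with q h2 h3 _
      rw [zero_add, sign_mul, sign_pos h2, one_mul, sign_pos h3, ← h1, sign_pos hc]
  · obtain ⟨t, h1, h2⟩ := (h.and (hlim'.eventually_const_lt ha)).exists
    filter_upwards [hlim.eventually_const_lt ha] with q hq _
    rw [← h1, sign_pos hq, sign_pos h2]

section Direction

variable {s : Fin p → SignType} {r : Fin p → Fin p → SignType}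
  {b u : EuclideanSpace ℝ (Fin p)}

/-- Two points of the ray lie in the subspace, so their difference, a nonzero multiple of `u`, does
too, and then `b`. -/
theorem mem_patternSpace_of_eventually
    (h : ∀ᶠ t in 𝓝[>] (0 : ℝ), HasSigns s r (b + t • u)) :
    b ∈ patternSpace s r ∧ u ∈ patternSpace s r := by
  obtain ⟨t₀, ht₀, h₀⟩ := (eventually_mem_nhdsWithin.and h).exists
  have hlt : ∀ᶠ t in 𝓝[>] (0 : ℝ), t < t₀ := nhdsWithin_le_nhds (eventually_lt_nhds ht₀)
  obtain ⟨t₁, ht₁, h₁⟩ := (hlt.and h).exists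
  have hu : u ∈ patternSpace s r := by
    have h3 := (patternSpace s r).sub_mem h₀.mem h₁.mem
    have h4 : b + t₀ • u - (b + t₁ • u) = (t₀ - t₁) • u := by rw [sub_smul]; abel
    rw [h4] at h3
    exact ((patternSpace s r).smul_mem_iff (sub_pos.2 ht₁).ne').1 h3
  refine ⟨?_, hu⟩
  have := (patternSpace s r).sub_mem h₀.mem ((patternSpace s r).smul_mem t₀ hu)
  simpa using this

/-- The signs of `b + t u` are locally constant in `u` along the pattern space. -/
theorem eventually_hasSigns_perturb
    (h : ∀ᶠ t in 𝓝[>] (0 : ℝ), HasSigns s r (b + t • u)) :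
    ∀ᶠ q in 𝓝[>] (0 : ℝ) ×ˢ 𝓝 u, q.2 ∈ patternSpace s r → HasSigns s r (b + q.1 • q.2) := by
  obtain ⟨hb, hu⟩ := mem_patternSpace_of_eventually h
  have h1 : ∀ i, ∀ᶠ q in 𝓝[>] (0 : ℝ) ×ˢ 𝓝 u, q.2 ∈ patternSpace s r →
      SignType.sign ((b + q.1 • q.2) i) = s i := fun i => by
    have hi : ∀ᶠ t in 𝓝[>] (0 : ℝ), SignType.sign (b i + t * u i) = s i := by
      filter_upwards [h] with t ht
      simpa using ht.1 i
    have ht : Tendsto (fun q : ℝ × EuclideanSpace ℝ (Fin p) => (q.1, q.2 i))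
        (𝓝[>] (0 : ℝ) ×ˢ 𝓝 u) (𝓝[>] (0 : ℝ) ×ˢ 𝓝 (u i)) :=
      tendsto_fst.prodMk (((Continuous.tendsto (by fun_prop) u :
        Tendsto (fun v : EuclideanSpace ℝ (Fin p) => v i) (𝓝 u) (𝓝 (u i)))).comp tendsto_snd)
    filter_upwards [ht.eventually (eventually_sign_perturb hi)] with q hq hmem
    simp only [PiLp.add_apply, PiLp.smul_apply, smul_eq_mul]
    exact hq fun hs => by simp [hb.1 i hs, hmem.1 i hs]
  have h2 : ∀ i j, ∀ᶠ q in 𝓝[>] (0 : ℝ) ×ˢ 𝓝 u, q.2 ∈ patternSpace s r →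
      SignType.sign (((s i : ℝ) * b i - (s j : ℝ) * b j) +
        q.1 * ((s i : ℝ) * q.2 i - (s j : ℝ) * q.2 j)) = r i j := fun i j => by
    have hij : ∀ᶠ t in 𝓝[>] (0 : ℝ), SignType.sign (((s i : ℝ) * b i - (s j : ℝ) * b j) +
        t * ((s i : ℝ) * u i - (s j : ℝ) * u j)) = r i j := by
      filter_upwards [h] with t ht
      rw [← ht.2 i j, ← sign_mul_self ((b + t • u) i), ← sign_mul_self ((b + t • u) j),
        ht.1, ht.1]
      simp only [PiLp.add_apply, PiLp.smul_apply, smul_eq_mul]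
      congr 1; ring
    have ht : Tendsto (fun q : ℝ × EuclideanSpace ℝ (Fin p) =>
        (q.1, (s i : ℝ) * q.2 i - (s j : ℝ) * q.2 j))
        (𝓝[>] (0 : ℝ) ×ˢ 𝓝 u) (𝓝[>] (0 : ℝ) ×ˢ 𝓝 ((s i : ℝ) * u i - (s j : ℝ) * u j)) :=
      tendsto_fst.prodMk (((Continuous.tendsto (by fun_prop) u :
        Tendsto (fun v : EuclideanSpace ℝ (Fin p) => (s i : ℝ) * v i - (s j : ℝ) * v j) (𝓝 u)
          (𝓝 _))).comp tendsto_snd)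
    filter_upwards [ht.eventually (eventually_sign_perturb hij)] with q hq hmem
    refine hq fun hr => ?_
    rw [hb.2 i j hr, hmem.2 i j hr]; ring
  filter_upwards [eventually_all.2 h1, eventually_all.2 fun i => eventually_all.2 (h2 i)]
    with q hq1 hq2 hmem
  refine ⟨fun i => hq1 i hmem, fun i j => ?_⟩
  rw [← hq2 i j hmem, ← sign_mul_self ((b + q.1 • q.2) i), ← sign_mul_self ((b + q.1 • q.2) j),
    hq1 i hmem, hq1 j hmem]
  simp only [PiLp.add_apply, PiLp.smul_apply, smul_eq_mul]
  congr 1; ring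

end Direction

/-! ### Directional derivatives and optimality conditions. -/

/-- By convexity the difference quotients decrease as the step shrinks to zero. -/
theorem dirDeriv_le {mu : Fin p → ℝ} (ha : Antitone mu) (h0 : ∀ i, 0 ≤ mu i)
    (b v : EuclideanSpace ℝ (Fin p)) {t : ℝ} (ht : 0 < t) :
    dirDeriv mu b v ≤ (J mu (b + t • v) - J mu b) / t := by
  refine le_of_tendsto (tendsto_dirDeriv mu b v) ?_
  filter_upwards [eventually_mem_nhdsWithin, nhdsWithin_le_nhds (eventually_lt_nhds ht)]
    with τ hτ hlt
  have hτ : 0 < τ := hτ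
  have hle : τ / t ≤ 1 := (div_le_one ht).2 hlt.le
  have hdec : b + τ • v = (1 - τ / t) • b + (τ / t) • (b + t • v) := by
    rw [smul_add, smul_smul, div_mul_cancel₀ _ ht.ne', sub_smul, one_smul]; abel
  have h1 := J_add_le ha h0 ((1 - τ / t) • b) ((τ / t) • (b + t • v))
  rw [← hdec, J_smul _ _ (sub_nonneg.2 hle), J_smul _ _ (by positivity)] at h1
  rw [div_le_div_iff₀ hτ ht]
  have h2 : τ / t * t = τ := div_mul_cancel₀ _ ht.ne'
  have h3 := mul_le_mul_of_nonneg_right h1 ht.le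
  linear_combination h3 + (J mu (b + t • v) - J mu b) * h2

/-- The signs and order along the ray are eventually fixed, so a single linear functional `g`
computes `J` there; limits at `0` identify its values at `b` and `u`. -/
theorem eventually_J_eq_dirDeriv (mu : Fin p → ℝ) (b u : EuclideanSpace ℝ (Fin p)) :
    ∀ᶠ t in 𝓝[>] (0 : ℝ), J mu (b + t • u) = J mu b + t * dirDeriv mu b u := by
  obtain ⟨s, r, h⟩ := eventually_signs b u
  have h : ∀ᶠ t in 𝓝[>] (0 : ℝ), HasSigns s r (b + t • u) := h
  obtain ⟨t₀, h₀⟩ := h.exists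
  set g := arrange (Tuple.sort fun j => -|(b + t₀ • u) j|) s mu
  have hJ : ∀ᶠ t in 𝓝[>] (0 : ℝ), J mu (b + t • u) = inner ℝ g b + t * inner ℝ g u := by
    filter_upwards [h] with t ht
    rw [(h₀.sorts ht).J_eq, inner_add_right, inner_smul_right]
  have ht0 : Tendsto (fun t : ℝ => t) (𝓝[>] 0) (𝓝 0) := nhdsWithin_le_nhds
  have hb : inner ℝ g b = J mu b := by
    have h1 : Tendsto (fun t : ℝ => inner ℝ g b + t * inner ℝ g u) (𝓝[>] 0)
        (𝓝 (inner ℝ g b + 0 * inner ℝ g u)) := (ht0.mul_const _).const_add _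
    have h2 := (((tendsto_dirDeriv mu b u).mul ht0).add_const (J mu b)).congr'
      (f₂ := fun t : ℝ => inner ℝ g b + t * inner ℝ g u) (by
        filter_upwards [hJ, eventually_mem_nhdsWithin] with t h3 h4
        rw [div_mul_cancel₀ _ (ne_of_gt h4), h3]; ring)
    simpa using tendsto_nhds_unique h1 h2
  have hu : dirDeriv mu b u = inner ℝ g u := by
    refine tendsto_nhds_unique (tendsto_dirDeriv mu b u) (tendsto_const_nhds.congr' ?_)
    filter_upwards [hJ, eventually_mem_nhdsWithin] with t h3 h4
    rw [h3, hb, add_sub_cancel_left, mul_div_cancel_left₀ _ (ne_of_gt h4)]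
  filter_upwards [hJ] with t ht
  rw [ht, hb, hu]

/-- A subgradient `f` of the SLOPE norm at `y` lies in the dual ball and supports it at `y`. -/
theorem subgradient_J {mu : Fin p → ℝ} {f y : EuclideanSpace ℝ (Fin p)}
    (h : ∀ z, inner ℝ f (z - y) ≤ J mu z - J mu y) :
    (∀ z, inner ℝ f z ≤ J mu z) ∧ inner ℝ f y = J mu y := by
  have h1 := h 0
  have h2 := h ((2 : ℝ) • y)
  rw [zero_sub, inner_neg_right, J_zero] at h1
  rw [J_smul _ _ zero_le_two, two_smul, add_sub_cancel_right] at h2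
  have h3 : inner ℝ f y = J mu y := by linarith
  refine ⟨fun z => ?_, h3⟩
  have := h z
  rw [inner_sub_right] at this
  linarith

/-- Optimality conditions for the limiting objective. -/
theorem eventually_subgradient_of_minimizer
    {A : EuclideanSpace ℝ (Fin p) →L[ℝ] EuclideanSpace ℝ (Fin p)}
    (hsymm : ∀ x y, inner ℝ (A x) y = inner ℝ (A y) x)
    {mu : Fin p → ℝ} (ha : Antitone mu) (h0 : ∀ i, 0 ≤ mu i)
    {b w u : EuclideanSpace ℝ (Fin p)}
    (hmin : ∀ v, (1 / 2) * inner ℝ (A u) u - inner ℝ u w + dirDeriv mu b u ≤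
      (1 / 2) * inner ℝ (A v) v - inner ℝ v w + dirDeriv mu b v) :
    ∀ᶠ t in 𝓝[>] (0 : ℝ), (∀ z, inner ℝ (w - A u) z ≤ J mu z) ∧
      inner ℝ (w - A u) (b + t • u) = J mu (b + t • u) := by
  filter_upwards [eventually_J_eq_dirDeriv mu b u, eventually_mem_nhdsWithin] with t hJ ht
  have ht : 0 < t := ht
  refine subgradient_J fun z => ?_
  set y := b + t • u with hy
  set d := z - y with hd
  -- Competitor `u + κ d`: the point `b + t (u + κ d)` is a convex combination of `y` and `z`, so
  -- the penalty grows by at most `κ (J z - J y)`. This yields a subgradient of `J` at `b + t u`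
  -- rather than only at `b`.
  have key : ∀ᶠ κ in 𝓝[>] (0 : ℝ),
      inner ℝ (w - A u) d ≤ (1 / 2) * κ * inner ℝ (A d) d + (J mu z - J mu y) := by
    filter_upwards [eventually_mem_nhdsWithin,
      nhdsWithin_le_nhds (eventually_lt_nhds (one_div_pos.2 ht))] with κ hκ hlt
    have hκ : 0 < κ := hκ
    have hθ : κ * t < 1 := by rwa [lt_div_iff₀ ht] at hlt
    have h1 := hmin (u + κ • d)
    have h2 := dirDeriv_le ha h0 b (u + κ • d) ht
    have hdec : b + t • (u + κ • d) = (1 - κ * t) • y + (κ * t) • z := by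
      rw [hd, hy]; module
    have h3 := J_add_le ha h0 ((1 - κ * t) • y) ((κ * t) • z)
    rw [J_smul _ _ (by linarith), J_smul _ _ (by positivity), ← hdec] at h3
    rw [le_div_iff₀ ht] at h2
    have h4 : inner ℝ (A (u + κ • d)) (u + κ • d) =
        inner ℝ (A u) u + 2 * κ * inner ℝ (A u) d + κ ^ 2 * inner ℝ (A d) d := by
      simp only [map_add, map_smul, inner_add_left, inner_add_right, inner_smul_left,
        inner_smul_right, RCLike.conj_to_real, hsymm d u]
      ring
    have h5 : inner ℝ (u + κ • d) w = inner ℝ u w + κ * inner ℝ w d := by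
      rw [inner_add_left, inner_smul_left, real_inner_comm w d]; simp
    rw [h4, h5] at h1
    rw [inner_sub_left]
    have h6 := mul_le_mul_of_nonneg_right h1 ht.le
    have h7 : 0 ≤ (κ * t) * ((1 / 2) * κ * inner ℝ (A d) d + (J mu z - J mu y) -
        (inner ℝ w d - inner ℝ (A u) d)) := by
      linear_combination h6 + h2 + h3 + hJ
    have h8 := nonneg_of_mul_nonneg_right h7 (by positivity)
    linarith
  have hlim : Tendsto (fun κ : ℝ => (1 / 2) * κ * inner ℝ (A d) d + (J mu z - J mu y)) (𝓝[>] 0)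
      (𝓝 ((1 / 2) * 0 * inner ℝ (A d) d + (J mu z - J mu y))) :=
    (Continuous.tendsto (by fun_prop) 0).mono_left nhdsWithin_le_nhds
  simpa using ge_of_tendsto hlim key

/-- On the pattern space a subgradient is determined by the pattern. -/
theorem inner_eq_of_subgradient {mu : Fin p → ℝ} {s : Fin p → SignType}
    {r : Fin p → Fin p → SignType} {π : Equiv.Perm (Fin p)}
    (hπ : ∀ b', HasSigns s r b' → Sorts π s b') {b u f : EuclideanSpace ℝ (Fin p)}
    (hs : ∀ᶠ t in 𝓝[>] (0 : ℝ), HasSigns s r (b + t • u))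
    (hf : ∀ᶠ t in 𝓝[>] (0 : ℝ), (∀ z, inner ℝ f z ≤ J mu z) ∧
      inner ℝ f (b + t • u) = J mu (b + t • u))
    {v : EuclideanSpace ℝ (Fin p)} (hv : v ∈ patternSpace s r) :
    inner ℝ f v = inner ℝ (arrange π s mu) v := by
  have hu := (mem_patternSpace_of_eventually hs).2
  obtain ⟨t, hst, ⟨hle, heq⟩, hpt, ht⟩ := (hs.and (hf.and
    ((eventually_hasSigns_perturb hs).curry.and eventually_mem_nhdsWithin))).exists
  have ht : 0 < t := ht
  have hc : ∀ c : ℝ, ∀ᶠ κ in 𝓝[>] (0 : ℝ), HasSigns s r (b + t • (u + (c * κ) • v)) := fun c => by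
    have : Tendsto (fun κ : ℝ => u + (c * κ) • v) (𝓝[>] 0) (𝓝 (u + (c * 0) • v)) :=
      (Continuous.tendsto (by fun_prop) 0).mono_left nhdsWithin_le_nhds
    rw [mul_zero, zero_smul, add_zero] at this
    filter_upwards [this.eventually hpt] with κ hκ
    exact hκ ((patternSpace s r).add_mem hu ((patternSpace s r).smul_mem _ hv))
  obtain ⟨κ, h1, h2, hκ⟩ := ((hc 1).and ((hc (-1)).and eventually_mem_nhdsWithin)).exists
  have hκ : 0 < κ := hκ
  -- Small moves along `v` and `-v` keep the signs, so `J` is linear there, while `f` stays below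
  -- `J` and touches it at `b + t u`. The cases `c = 1` and `c = -1` give the two inequalities.
  have key : ∀ c : ℝ, HasSigns s r (b + t • (u + (c * κ) • v)) →
      c * inner ℝ f v ≤ c * inner ℝ (arrange π s mu) v := fun c h => by
    have h3 := hle (b + t • (u + (c * κ) • v))
    rw [(hπ _ h).J_eq] at h3
    rw [(hπ _ hst).J_eq] at heq
    have hdec : b + t • (u + (c * κ) • v) = (b + t • u) + (t * κ * c) • v := by module
    rw [hdec, inner_add_right _ (b + t • u), inner_add_right _ (b + t • u), heq, inner_smul_right,
      inner_smul_right] at h3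
    have h4 : 0 ≤ (t * κ) * (c * inner ℝ (arrange π s mu) v - c * inner ℝ f v) := by
      linear_combination h3
    have h5 := nonneg_of_mul_nonneg_right h4 (by positivity)
    linarith
  have := key 1 h1
  have := key (-1) h2
  linarith

/-! ### Linear equations compressed to a subspace. -/

section Galerkin

variable {E : Type*} [NormedAddCommGroup E] [InnerProductSpace ℝ E] [FiniteDimensional ℝ E]

/-- Compression of an operator to a subspace. -/
noncomputable def compression (T : Submodule ℝ E) : (E →L[ℝ] E) →L[ℝ] (T →L[ℝ] T) :=
  (ContinuousLinearMap.compL ℝ T E T T.orthogonalProjectionOnto).comp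
    ((ContinuousLinearMap.compL ℝ T E E).flip T.subtypeL)

theorem compression_apply (T : Submodule ℝ E) (A : E →L[ℝ] E) (x : T) :
    compression T A x = T.orthogonalProjectionOnto (A x) := rfl

/-- Positivity of the quadratic form passes to `T` and gives injectivity, which suffices in finite
dimension. -/
theorem isUnit_compression (T : Submodule ℝ E) {A : E →L[ℝ] E}
    (hA : ∀ v, v ≠ 0 → 0 < inner ℝ (A v) v) : IsUnit (compression T A) := by
  rw [ContinuousLinearMap.isUnit_iff_bijective]
  have hinj : Function.Injective (compression T A : T →ₗ[ℝ] T) := by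
    rw [← LinearMap.ker_eq_bot, LinearMap.ker_eq_bot']
    intro x hx
    by_contra hne
    have h1 := hA x (by simpa using hne)
    have h2 : inner ℝ (compression T A x) x = 0 := by
      rw [show compression T A x = 0 from hx, inner_zero_left]
    rw [compression_apply, Submodule.inner_orthogonalProjectionOnto_eq_of_mem_right] at h2
    exact h1.ne' h2
  exact ⟨hinj, LinearMap.injective_iff_surjective.1 hinj⟩

theorem exists_galerkin (T : Submodule ℝ E) {A : E →L[ℝ] E}
    (hA : ∀ v, v ≠ 0 → 0 < inner ℝ (A v) v) (y : E) :
    ∃ u ∈ T, ∀ v ∈ T, inner ℝ (A u) v = inner ℝ y v := by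
  obtain ⟨x, hx⟩ := ((ContinuousLinearMap.isUnit_iff_bijective).1 (isUnit_compression T hA)).2
    (T.orthogonalProjectionOnto y)
  refine ⟨x, x.2, fun v hv => ?_⟩
  have := congrArg (fun z : T => inner ℝ z (⟨v, hv⟩ : T)) hx
  simpa only [compression_apply, Submodule.inner_orthogonalProjectionOnto_eq_of_mem_right] using this

theorem tendsto_inverse_apply {F : Type*} [NormedAddCommGroup F] [NormedSpace ℝ F]
    [CompleteSpace F] {B : F →L[ℝ] F} (hB : IsUnit B) (x : F) :
    Tendsto (fun q : (F →L[ℝ] F) × F => Ring.inverse q.1 q.2) (𝓝 (B, x))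
      (𝓝 (Ring.inverse B x)) := by
  have h1 : ContinuousAt (Ring.inverse : (F →L[ℝ] F) → (F →L[ℝ] F)) B := by
    obtain ⟨U, rfl⟩ := hB
    exact NormedRing.inverse_continuousAt U
  have h2 : Tendsto (fun q : (F →L[ℝ] F) × F => Ring.inverse q.1) (𝓝 (B, x))
      (𝓝 (Ring.inverse B)) := h1.tendsto.comp (continuous_fst.tendsto (B, x))
  exact (isBoundedBilinearMap_apply.continuous.tendsto (Ring.inverse B, x)).comp
    (h2.prodMk_nhds (continuous_snd.tendsto (B, x)))

/-- The solution of the compressed equation depends continuously on the data. -/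
theorem exists_continuous_galerkin (T : Submodule ℝ E) {A : E →L[ℝ] E}
    (hA : ∀ v, v ≠ 0 → 0 < inner ℝ (A v) v) {y u : E} (hu : u ∈ T)
    (hAu : ∀ v ∈ T, inner ℝ (A u) v = inner ℝ y v) :
    ∃ sol : (E →L[ℝ] E) × E → E, Tendsto sol (𝓝 (A, y)) (𝓝 u) ∧ (∀ q, sol q ∈ T) ∧
      ∀ᶠ q in 𝓝 (A, y), ∀ v ∈ T, inner ℝ (q.1 (sol q)) v = inner ℝ q.2 v := by
  have hunit := isUnit_compression T hA
  -- `Ring.inverse` is `0` at non-units, so this is defined for all data and always lies in `T`; it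
  -- solves the equation where the compression is invertible, an open condition.
  refine ⟨fun q => (Ring.inverse (compression T q.1) (T.orthogonalProjectionOnto q.2) : T), ?_,
    fun q => Subtype.coe_prop _, ?_⟩
  · have : CompleteSpace T := FiniteDimensional.complete ℝ T
    have h1 : compression T A ⟨u, hu⟩ = T.orthogonalProjectionOnto y := by
      refine ext_inner_right ℝ fun v => ?_
      rw [compression_apply, Submodule.inner_orthogonalProjectionOnto_eq_of_mem_right,
        Submodule.inner_orthogonalProjectionOnto_eq_of_mem_right]
      exact hAu v v.2
    have h2 : Ring.inverse (compression T A) (T.orthogonalProjectionOnto y) = ⟨u, hu⟩ := by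
      rw [← h1, ← mul_apply_eq_comp, Ring.inverse_mul_cancel _ hunit]; rfl
    have h3 : Continuous fun q : (E →L[ℝ] E) × E =>
        (compression T q.1, T.orthogonalProjectionOnto q.2) :=
      ((compression T).continuous.comp continuous_fst).prodMk
        (T.orthogonalProjectionOnto.continuous.comp continuous_snd)
    have h4 := (tendsto_inverse_apply hunit (T.orthogonalProjectionOnto y)).comp
      (h3.tendsto (A, y))
    have h7 := (continuous_subtype_val.tendsto _).comp h4
    simp only [h2] at h7
    exact h7
  · have hopen : ∀ᶠ q in 𝓝 (A, y), IsUnit (compression T q.1) := by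
      have : Tendsto (fun q : (E →L[ℝ] E) × E => compression T q.1) (𝓝 (A, y))
        (𝓝 (compression T A)) :=
        ((compression T).continuous.comp continuous_fst).tendsto (A, y)
      have hT : CompleteSpace T := FiniteDimensional.complete ℝ T
      have hU : {B : T →L[ℝ] T | IsUnit B} ∈ 𝓝 (compression T A) :=
        (Units.isOpen (R := T →L[ℝ] T)).mem_nhds hunit
      exact this.eventually hU
    filter_upwards [hopen] with q hq v hv
    set x := Ring.inverse (compression T q.1) (T.orthogonalProjectionOnto q.2)
    have h1 : compression T q.1 x = T.orthogonalProjectionOnto q.2 := by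
      rw [← mul_apply_eq_comp, Ring.mul_inverse_cancel _ hq]; rfl
    have := congrArg (fun z : T => inner ℝ z (⟨v, hv⟩ : T)) h1
    simpa only [compression_apply, Submodule.inner_orthogonalProjectionOnto_eq_of_mem_right] using this

/-- Compactness of the unit sphere makes positivity uniform; homogeneity extends it to all nonzero
vectors. -/
theorem eventually_pos_inner {A : E →L[ℝ] E} (hA : ∀ v, v ≠ 0 → 0 < inner ℝ (A v) v) :
    ∀ᶠ B in 𝓝 A, ∀ v, v ≠ 0 → 0 < inner ℝ (B v) v := by
  have h := (isCompact_sphere (0 : E) 1).eventually_forall_of_forall_eventually (x₀ := A)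
    (P := fun B v => 0 < inner ℝ (B v) v) (fun v hv => by
      have hv0 : v ≠ 0 := fun h => by simp [h] at hv
      have : Tendsto (fun q : (E →L[ℝ] E) × E => inner ℝ (q.1 q.2) q.2) (𝓝 (A, v))
        (𝓝 (inner ℝ (A v) v)) := Continuous.tendsto (by fun_prop) (A, v)
      exact this.eventually_const_lt (hA v hv0))
  filter_upwards [h] with B hB v hv
  have hn : 0 < ‖v‖ := norm_pos_iff.2 hv
  have h1 := hB (‖v‖⁻¹ • v) (by simp [norm_smul, hn.ne'])
  rw [map_smul, inner_smul_left, inner_smul_right] at h1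
  simp only [RCLike.conj_to_real] at h1
  exact pos_of_mul_pos_right (pos_of_mul_pos_right h1 (by positivity)) (by positivity)

end Galerkin

/-! ### Degenerate hyperplanes and local stability of the pattern. -/

/-- The values of `w` for which a reduced solution with pattern data `π, s, r` meets the dual
constraint of the sign vector `σ` with equality. -/
def degenerateSet (A : EuclideanSpace ℝ (Fin p) →L[ℝ] EuclideanSpace ℝ (Fin p))
    (mu : Fin p → ℝ) (π : Equiv.Perm (Fin p)) (s : Fin p → SignType)
    (r : Fin p → Fin p → SignType) (σ : Fin p → SignType) : Set (EuclideanSpace ℝ (Fin p)) :=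
  {w | ∃ u ∈ patternSpace s r,
    (∀ v ∈ patternSpace s r, inner ℝ (w - A u) v = inner ℝ (arrange π s mu) v) ∧
      inner ℝ (w - A u) (signVec σ) = J mu (signVec σ)}

/-- The normal `z` is `signVec σ` minus its `A`-orthogonal projection `v` onto the pattern space. It
is nonzero by `hσ`, and pairing with it eliminates the unknown `u`, leaving an equation in `w`
alone. -/
theorem degenerateSet_subset_hyperplane
    {A : EuclideanSpace ℝ (Fin p) →L[ℝ] EuclideanSpace ℝ (Fin p)}
    (hsymm : ∀ x y, inner ℝ (A x) y = inner ℝ (A y) x)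
    (hA : ∀ v, v ≠ 0 → 0 < inner ℝ (A v) v) (mu : Fin p → ℝ) (π : Equiv.Perm (Fin p))
    {s : Fin p → SignType} {r : Fin p → Fin p → SignType} {σ : Fin p → SignType}
    (hσ : signVec σ ∉ patternSpace s r) :
    ∃ z : EuclideanSpace ℝ (Fin p), z ≠ 0 ∧ ∃ c : ℝ,
      degenerateSet A mu π s r σ ⊆ {w | inner ℝ z w = c} := by
  obtain ⟨v, hv, hAv⟩ := exists_galerkin (patternSpace s r) hA (A (signVec σ))
  refine ⟨signVec σ - v, fun h => hσ (by rwa [sub_eq_zero.1 h]),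
    J mu (signVec σ) - inner ℝ (arrange π s mu) v, ?_⟩
  rintro w ⟨u, hu, h1, h2⟩
  have h3 : inner ℝ (A u) (signVec σ - v) = 0 := by
    rw [inner_sub_right, hsymm, hsymm u v, hAv u hu, sub_self]
  rw [Set.mem_ofPred_eq, ← h2, ← h1 v hv, ← inner_sub_right (w - A u), inner_sub_left w, h3,
    sub_zero, real_inner_comm]

/-- The data `(A, w, mu, t)` for which the optimality conditions with quadratic part `A`, linear
part `w` and penalty `mu` hold at some `u` such that `b + t u` has the pattern `𝔭`. -/
def patternSolvable (b : EuclideanSpace ℝ (Fin p)) (𝔭 : Fin p → ℤ) :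
    Set ((EuclideanSpace ℝ (Fin p) →L[ℝ] EuclideanSpace ℝ (Fin p)) ×
      EuclideanSpace ℝ (Fin p) × (Fin p → ℝ) × ℝ) :=
  -- Inadmissible data belong to the set vacuously. This lets the set be a neighbourhood of a limit
  -- point with `t = 0` and weights on the boundary of the admissible cone.
  {q | Antitone q.2.2.1 → (∀ i, 0 ≤ q.2.2.1 i) → 0 < q.2.2.2 →
    (∀ v, v ≠ 0 → 0 < inner ℝ (q.1 v) v) ∧
    ∃ u, patt (b + q.2.2.2 • u) = 𝔭 ∧ (∀ z, inner ℝ (q.2.1 - q.1 u) z ≤ J q.2.2.1 z) ∧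
      inner ℝ (q.2.1 - q.1 u) (b + q.2.2.2 • u) = J q.2.2.1 (b + q.2.2.2 • u)}

/-- Outside the degenerate sets the limiting pattern is locally stable. -/
theorem patternSolvable_mem_nhds
    {A : EuclideanSpace ℝ (Fin p) →L[ℝ] EuclideanSpace ℝ (Fin p)}
    (hsymm : ∀ x y, inner ℝ (A x) y = inner ℝ (A y) x)
    (hA : ∀ v, v ≠ 0 → 0 < inner ℝ (A v) v)
    {mu : Fin p → ℝ} (ha : Antitone mu) (h0 : ∀ i, 0 ≤ mu i)
    {b w u : EuclideanSpace ℝ (Fin p)}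
    (hmin : ∀ v, (1 / 2) * inner ℝ (A u) u - inner ℝ u w + dirDeriv mu b u ≤
      (1 / 2) * inner ℝ (A v) v - inner ℝ v w + dirDeriv mu b v)
    (hw : ∀ π s r σ, signVec σ ∉ patternSpace s r → w ∉ degenerateSet A mu π s r σ) :
    patternSolvable b (limitPatt b u) ∈ 𝓝 (A, w, mu, (0 : ℝ)) := by
  obtain ⟨s, r, h⟩ := eventually_signs b u
  have hs : ∀ᶠ t in 𝓝[>] (0 : ℝ), HasSigns s r (b + t • u) := h
  obtain ⟨t₀, h₀, hpatt⟩ := (hs.and (eventually_patt_eq b u)).exists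
  set π := Tuple.sort fun j => -|(b + t₀ • u) j|
  have hπ : ∀ b', HasSigns s r b' → Sorts π s b' := fun b' => h₀.sorts
  have hf := eventually_subgradient_of_minimizer hsymm ha h0 hmin
  obtain ⟨hb, hu⟩ := mem_patternSpace_of_eventually hs
  have hfT : ∀ v ∈ patternSpace s r, inner ℝ (w - A u) v = inner ℝ (arrange π s mu) v :=
    fun v hv => inner_eq_of_subgradient hπ hs hf hv
  have hle : ∀ z, inner ℝ (w - A u) z ≤ J mu z := hf.exists.choose_spec.1
  have hstrict : ∀ σ, signVec σ ∉ patternSpace s r →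
      inner ℝ (w - A u) (signVec σ) < J mu (signVec σ) := fun σ hσ =>
    lt_of_le_of_ne (hle _) fun he => hw π s r σ hσ ⟨u, hu, hfT, he⟩
  -- On the pattern space the subgradient must equal `arrange π s mu`, which is the linear equation
  -- `A u = w - arrange π s mu` tested on that space.
  obtain ⟨sol, hsol, hsolT, hsolA⟩ := exists_continuous_galerkin (patternSpace s r) hA
    (y := w - arrange π s mu) hu fun v hv => by
      have := hfT v hv
      rw [inner_sub_left] at this ⊢
      linarith
  set dat : (EuclideanSpace ℝ (Fin p) →L[ℝ] EuclideanSpace ℝ (Fin p)) ×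
      EuclideanSpace ℝ (Fin p) × (Fin p → ℝ) × ℝ →
      (EuclideanSpace ℝ (Fin p) →L[ℝ] EuclideanSpace ℝ (Fin p)) × EuclideanSpace ℝ (Fin p) :=
    fun q => (q.1, q.2.1 - arrange π s q.2.2.1) with hdat
  have hcont : Continuous dat := by
    have := continuous_arrange π s
    fun_prop
  have hdat0 : Tendsto dat (𝓝 (A, w, mu, (0 : ℝ))) (𝓝 (A, w - arrange π s mu)) :=
    hcont.tendsto (A, w, mu, (0 : ℝ))
  have hsol' := hsol.comp hdat0
  have hpair : Tendsto (fun q => (q.2.2.2, sol (dat q)))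
      (𝓝 (A, w, mu, (0 : ℝ)) ⊓ 𝓟 {q | 0 < q.2.2.2}) (𝓝[>] (0 : ℝ) ×ˢ 𝓝 u) := by
    refine Tendsto.prodMk ?_ (hsol'.mono_left inf_le_left)
    refine tendsto_nhdsWithin_iff.2 ⟨?_, ?_⟩
    · exact (Continuous.tendsto (by fun_prop) (A, w, mu, (0 : ℝ))).mono_left inf_le_left
    · exact (mem_principal_self _ : _ ∈ 𝓟 _) |> mem_inf_of_right
  have hsigns := eventually_inf_principal.1
    (hpair.eventually (eventually_hasSigns_perturb hs))
  have hnear : ∀ σ, signVec σ ∉ patternSpace s r → ∀ᶠ q in 𝓝 (A, w, mu, (0 : ℝ)),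
      inner ℝ (q.2.1 - q.1 (sol (dat q))) (signVec σ) < J q.2.2.1 (signVec σ) := fun σ hσ => by
    have h1 : Tendsto (fun q : (EuclideanSpace ℝ (Fin p) →L[ℝ] EuclideanSpace ℝ (Fin p)) ×
        EuclideanSpace ℝ (Fin p) × (Fin p → ℝ) × ℝ =>
        inner ℝ (q.2.1 - q.1 (sol (dat q))) (signVec σ)) (𝓝 (A, w, mu, (0 : ℝ)))
        (𝓝 (inner ℝ (w - A u) (signVec σ))) := by
      have h2 : Tendsto (fun q : (EuclideanSpace ℝ (Fin p) →L[ℝ] EuclideanSpace ℝ (Fin p)) ×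
        EuclideanSpace ℝ (Fin p) × (Fin p → ℝ) × ℝ => q.1 (sol (dat q)))
        (𝓝 (A, w, mu, (0 : ℝ))) (𝓝 (A u)) :=
        (isBoundedBilinearMap_apply.continuous.tendsto (A, u)).comp
          ((continuous_fst.tendsto (A, w, mu, (0 : ℝ))).prodMk_nhds hsol')
      have h3 : Tendsto (fun q : (EuclideanSpace ℝ (Fin p) →L[ℝ] EuclideanSpace ℝ (Fin p)) ×
        EuclideanSpace ℝ (Fin p) × (Fin p → ℝ) × ℝ => q.2.1)
        (𝓝 (A, w, mu, (0 : ℝ))) (𝓝 w) := Continuous.tendsto (by fun_prop) (A, w, mu, (0 : ℝ))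
      exact (h3.sub h2).inner tendsto_const_nhds
    have h4 : Tendsto (fun q : (EuclideanSpace ℝ (Fin p) →L[ℝ] EuclideanSpace ℝ (Fin p)) ×
        EuclideanSpace ℝ (Fin p) × (Fin p → ℝ) × ℝ => J q.2.2.1 (signVec σ))
        (𝓝 (A, w, mu, (0 : ℝ))) (𝓝 (J mu (signVec σ))) :=
      ((continuous_J_left (signVec σ)).comp (continuous_fst.comp
        (continuous_snd.comp continuous_snd))).tendsto (A, w, mu, (0 : ℝ))
    exact h1.eventually_lt h4 (hstrict σ hσ)
  have hpos : ∀ᶠ q in 𝓝 (A, w, mu, (0 : ℝ)), ∀ v, v ≠ 0 → 0 < inner ℝ (q.1 v) v :=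
    (continuous_fst.tendsto (A, w, mu, (0 : ℝ))).eventually (eventually_pos_inner hA)
  filter_upwards [hsigns, hpos, hdat0.eventually hsolA,
    eventually_all.2 fun σ => eventually_all.2 (hnear σ)] with q h1 h2 h3 h4 hqa hq0 hqt
  have hsg : HasSigns s r (b + q.2.2.2 • sol (dat q)) := h1 hqt (hsolT _)
  have hT : ∀ v ∈ patternSpace s r,
      inner ℝ (q.2.1 - q.1 (sol (dat q))) v = inner ℝ (arrange π s q.2.2.1) v := fun v hv => by
    have := h3 v hv
    simp only [hdat] at this ⊢
    rw [inner_sub_left] at this ⊢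
    linarith
  refine ⟨h2, sol (dat q), ?_, ?_, ?_⟩
  · rw [← hpatt]
    exact hsg.patt_eq h₀
  -- Sign vectors inside the pattern space satisfy the constraint by the rearrangement inequality;
  -- the finitely many others by persistence of strictness.
  · refine inner_le_J_of_signVec fun σ => ?_
    by_cases hσ : signVec σ ∈ patternSpace s r
    · rw [hT _ hσ]
      exact inner_arrange_le hqa hq0 π s _
    · exact (h4 σ hσ).le
  · rw [hT _ hsg.mem, (hπ _ hsg).J_eq]

/-! ### From solvable rescaled data to the pattern of the estimator. -/

/-- The empirical second moment operator of the first `n` regressors. -/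
noncomputable def empCov (n : ℕ) (x : ℕ → EuclideanSpace ℝ (Fin p)) :
    EuclideanSpace ℝ (Fin p) →L[ℝ] EuclideanSpace ℝ (Fin p) :=
  (n : ℝ)⁻¹ • ∑ i ∈ Finset.range n, InnerProductSpace.rankOne ℝ (x i) (x i)

/-- The normalized score `n^{-1/2} ∑ e i • x i`. -/
noncomputable def score (n : ℕ) (x : ℕ → EuclideanSpace ℝ (Fin p)) (e : ℕ → ℝ) :
    EuclideanSpace ℝ (Fin p) :=
  (√(n : ℝ))⁻¹ • ∑ i ∈ Finset.range n, e i • x i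

theorem inner_empCov {n : ℕ} (hn : 0 < n) (x : ℕ → EuclideanSpace ℝ (Fin p))
    (u v : EuclideanSpace ℝ (Fin p)) :
    ∑ i ∈ Finset.range n, inner ℝ (x i) u * inner ℝ (x i) v = n * inner ℝ (empCov n x u) v := by
  have : (n : ℝ) ≠ 0 := by positivity
  simp only [empCov, smul_apply, sum_apply,
    inner_smul_left, sum_inner, InnerProductSpace.rankOne_apply, RCLike.conj_to_real]
  rw [mul_inv_cancel_left₀ this]

/-- If the rescaled data are pattern solvable then the SLOPE estimator has that pattern. -/
theorem patt_eq_of_patternSolvable {n : ℕ} (hn : 0 < n) {x : ℕ → EuclideanSpace ℝ (Fin p)}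
    {e : ℕ → ℝ} {lam : Fin p → ℝ} (ha : Antitone lam) (h0 : ∀ i, 0 ≤ lam i)
    {b bhat : EuclideanSpace ℝ (Fin p)} {𝔭 : Fin p → ℤ}
    (hq : (empCov n x, score n x e, (fun i => lam i / √(n : ℝ)), (√(n : ℝ))⁻¹) ∈
      patternSolvable b 𝔭)
    (hmin : ∀ z, objective n x (fun i => inner ℝ (x i) b + e i) lam bhat ≤
      objective n x (fun i => inner ℝ (x i) b + e i) lam z) :
    patt bhat = 𝔭 := by
  have hc : 0 < √(n : ℝ) := by positivity
  set c := √(n : ℝ) with hcdef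
  have hcn : c ^ 2 = n := Real.sq_sqrt (by positivity)
  set mu : Fin p → ℝ := fun i => lam i / c with hmu
  have hlam : lam = c • mu := by
    ext i; simp [hmu, mul_div_cancel₀ _ hc.ne']
  obtain ⟨hpos, u, hpatt, hle, heq⟩ := hq (fun i j hij => div_le_div_of_nonneg_right (ha hij) hc.le)
    (fun i => div_nonneg (h0 i) hc.le) (inv_pos.2 hc)
  simp only at hpos hpatt hle heq
  set bs := b + c⁻¹ • u with hbs
  set A := empCov n x with hA
  set f := score n x e - A u with hf
  rw [← hpatt]
  congr 1
  -- `bs` satisfies the optimality conditions of the unscaled problem. Any other point has a larger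
  -- objective, by at least `(n / 2) ⟨A d, d⟩ > 0`, so the minimizer must be `bs`.
  by_contra hne
  set d := bhat - bs with hd
  have hd0 : d ≠ 0 := sub_ne_zero.2 hne
  have hbhat : bhat = bs + d := by rw [hd]; abel
  have h1 : ∀ i, inner ℝ (x i) b + e i - inner ℝ (x i) bhat =
      (inner ℝ (x i) b + e i - inner ℝ (x i) bs) - inner ℝ (x i) d := fun i => by
    rw [hbhat, inner_add_right (x i) bs]; ring
  have h2 : ∀ i, inner ℝ (x i) b + e i - inner ℝ (x i) bs = e i - c⁻¹ * inner ℝ (x i) u :=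
    fun i => by rw [hbs, inner_add_right, inner_smul_right]; ring
  have h3 : ∑ i ∈ Finset.range n, e i * inner ℝ (x i) d = c * inner ℝ (score n x e) d := by
    rw [score, inner_smul_left, sum_inner, RCLike.conj_to_real, mul_inv_cancel_left₀ hc.ne']
    exact Finset.sum_congr rfl fun i _ => by rw [inner_smul_left, RCLike.conj_to_real]
  have h4 := inner_empCov hn x u d
  have h5 := inner_empCov hn x d d
  rw [← hA] at h4 h5
  have h6 : ∑ i ∈ Finset.range n, (inner ℝ (x i) b + e i - inner ℝ (x i) bhat) ^ 2 =
      ∑ i ∈ Finset.range n, (inner ℝ (x i) b + e i - inner ℝ (x i) bs) ^ 2 -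
      2 * (c * inner ℝ f d) + n * inner ℝ (A d) d := by
    have h7 : c * inner ℝ f d = c * inner ℝ (score n x e) d - c⁻¹ * (n * inner ℝ (A u) d) := by
      rw [hf, inner_sub_left, ← hcn]; field_simp
    rw [h7, ← h3, ← h4, ← h5, Finset.mul_sum, ← Finset.sum_sub_distrib, Finset.mul_sum,
      ← Finset.sum_sub_distrib, ← Finset.sum_add_distrib]
    refine Finset.sum_congr rfl fun i _ => ?_
    rw [h1, h2]; ring
  have h8 := hmin bs
  have h9 := hle bhat
  simp only [objective, h6, hlam, J_smul_left] at h8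
  rw [hbhat, inner_add_right, heq, ← hbhat] at h9
  have h10 := mul_le_mul_of_nonneg_left h9 hc.le
  have h11 : 0 < (n : ℝ) * inner ℝ (A d) d := mul_pos (by positivity) (hpos d hd0)
  linarith

/-! ### Limit theorems for the rescaled data. -/

section Independence

variable {Ω ι β γ : Type*} {mΩ : MeasurableSpace Ω} {P : Measure Ω}
  {mβ : MeasurableSpace β} {mγ : MeasurableSpace γ} {X : ι → Ω → β} {Y : ι → Ω → γ}

/-- Two independent families of independent variables form an independent family of pairs. -/
theorem iIndepFun_prodMk (hX : ∀ i, Measurable (X i)) (hY : ∀ i, Measurable (Y i))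
    (hXi : iIndepFun X P) (hYi : iIndepFun Y P)
    (hXY : IndepFun (fun ω i => X i ω) (fun ω i => Y i ω) P) :
    iIndepFun (fun i ω => (X i ω, Y i ω)) P := by
  classical
  have hpi : ∀ S : Finset ι, ∀ (A : ι → Set β) (B : ι → Set γ),
      (∀ i ∈ S, MeasurableSet (A i)) → (∀ i ∈ S, MeasurableSet (B i)) →
      P (⋂ i ∈ S, (X i ⁻¹' A i ∩ Y i ⁻¹' B i)) =
        ∏ i ∈ S, (P (X i ⁻¹' A i) * P (Y i ⁻¹' B i)) := by
    intro S A B hA hB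
    have h1 : (⋂ i ∈ S, (X i ⁻¹' A i ∩ Y i ⁻¹' B i)) =
        (fun ω i => X i ω) ⁻¹' (⋂ i ∈ S, Function.eval i ⁻¹' A i) ∩
        (fun ω i => Y i ω) ⁻¹' (⋂ i ∈ S, Function.eval i ⁻¹' B i) := by
      ext ω
      simp only [Set.mem_iInter, Set.mem_inter_iff, Set.mem_preimage, Function.eval]
      exact ⟨fun h => ⟨fun i hi => (h i hi).1, fun i hi => (h i hi).2⟩,
        fun h i hi => ⟨h.1 i hi, h.2 i hi⟩⟩
    rw [h1, hXY.measure_inter_preimage_eq_mul _ _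
      (Finset.measurableSet_biInter _ fun i hi => measurable_pi_apply i (hA i hi))
      (Finset.measurableSet_biInter _ fun i hi => measurable_pi_apply i (hB i hi)),
      Finset.prod_mul_distrib, ← hXi.measure_inter_preimage_eq_mul S hA,
      ← hYi.measure_inter_preimage_eq_mul S hB]
    simp only [Set.preimage_iInter]
    rfl
  rw [iIndepFun_iff_iIndep]
  refine iIndepSets.iIndep (fun i => ((hX i).prodMk (hY i)).comap_le)
    (fun i => Set.preimage (fun ω => (X i ω, Y i ω)) ''
      Set.image2 (· ×ˢ ·) {s : Set β | MeasurableSet s} {t : Set γ | MeasurableSet t})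
    (fun i => isPiSystem_prod.comap _) (fun i => ?_) ?_
  · rw [← MeasurableSpace.comap_generateFrom, generateFrom_prod]
  · rw [iIndepSets_iff]
    intro S f hf
    -- It suffices to test on rectangles, a generating π-system; for indices outside `S` the sets
    -- are placeholders.
    have hf' : ∀ i, ∃ (A : Set β) (B : Set γ), i ∈ S → MeasurableSet A ∧ MeasurableSet B ∧
        f i = X i ⁻¹' A ∩ Y i ⁻¹' B := fun i => by
      by_cases hi : i ∈ S
      · obtain ⟨_, ⟨A, hA, B, hB, rfl⟩, h⟩ := hf i hi
        exact ⟨A, B, fun _ => ⟨hA, hB, h.symm⟩⟩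
      · exact ⟨∅, ∅, fun h => absurd h hi⟩
    choose A B hAB using hf'
    rw [Set.iInter₂_congr fun i hi => (hAB i hi).2.2,
      hpi S A B (fun i hi => (hAB i hi).1) fun i hi => (hAB i hi).2.1]
    refine Finset.prod_congr rfl fun i hi => ?_
    have := hpi {i} A B (by simpa using (hAB i hi).1) (by simpa using (hAB i hi).2.1)
    simpa [(hAB i hi).2.2] using this.symm

end Independence

variable {Ω : Type*} [MeasurableSpace Ω] {P : Measure Ω}
  {C : Matrix (Fin p) (Fin p) ℝ}

theorem memLp_inner {Z : Ω → EuclideanSpace ℝ (Fin p)} (hZ : MemLp Z 2 P)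
    (u : EuclideanSpace ℝ (Fin p)) : MemLp (fun ω => inner ℝ (Z ω) u) 2 P := by
  simpa only [real_inner_comm] using hZ.const_inner u

variable [IsProbabilityMeasure P]

theorem integral_inner_mul_inner {Z : Ω → EuclideanSpace ℝ (Fin p)} (hZ : MemLp Z 2 P)
    (hmean : ∫ ω, Z ω ∂P = 0)
    (hcov : ∀ j k, cov[fun ω => Z ω j, fun ω => Z ω k; P] = C j k)
    (u v : EuclideanSpace ℝ (Fin p)) :
    ∫ ω, inner ℝ (Z ω) u * inner ℝ (Z ω) v ∂P =
      inner ℝ v (Matrix.toEuclideanCLM (𝕜 := ℝ) C u) := by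
  have hcoord : ∀ j, MemLp (fun ω => Z ω j) 2 P := fun j =>
    (EuclideanSpace.proj (𝕜 := ℝ) j).comp_memLp' hZ
  have hint : Integrable Z P := hZ.integrable one_le_two
  have hm : ∀ j, ∫ ω, Z ω j ∂P = 0 := fun j => by
    have := (EuclideanSpace.proj (𝕜 := ℝ) j).integral_comp_comm hint
    rw [hmean, map_zero] at this
    exact this
  have hjk : ∀ j k, ∫ ω, Z ω j * Z ω k ∂P = C j k := fun j k => by
    rw [← hcov, covariance_eq_sub (hcoord j) (hcoord k)]
    simp [hm]
  have h1 : ∀ ω, inner ℝ (Z ω) u * inner ℝ (Z ω) v =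
      ∑ j, ∑ k, (v j * u k) * (Z ω j * Z ω k) := fun ω => by
    rw [PiLp.inner_apply, PiLp.inner_apply, mul_comm, Finset.sum_mul_sum]
    refine Finset.sum_congr rfl fun j _ => Finset.sum_congr rfl fun k _ => ?_
    simp; ring
  have hjkint : ∀ j k, Integrable (fun ω => (v j * u k) * (Z ω j * Z ω k)) P := fun j k =>
    ((hcoord j).integrable_mul (hcoord k)).const_mul _
  simp_rw [h1]
  rw [integral_finsetSum _ fun j _ => integrable_finsetSum _ fun k _ => hjkint j k,
    Matrix.inner_toEuclideanCLM]
  simp only [dotProduct, Matrix.mulVec, Finset.mul_sum]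
  refine Finset.sum_congr rfl fun j _ => ?_
  rw [integral_finsetSum _ fun k _ => hjkint j k]
  refine Finset.sum_congr rfl fun k _ => ?_
  rw [integral_const_mul, hjk]; ring

/-- The empirical second moment operators converge almost surely. -/
theorem ae_tendsto_empCov {X : ℕ → Ω → EuclideanSpace ℝ (Fin p)}
    (hXindep : iIndepFun X P) (hXident : ∀ i, IdentDistrib (X i) (X 0) P P)
    (hXL2 : MemLp (X 0) 2 P) (hXmean : ∫ ω, X 0 ω ∂P = 0)
    (hXcov : ∀ j k, cov[fun ω => X 0 ω j, fun ω => X 0 ω k; P] = C j k) :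
    ∀ᵐ ω ∂P, Tendsto (fun n => empCov n fun i => X i ω) atTop
      (𝓝 (Matrix.toEuclideanCLM (𝕜 := ℝ) C)) := by
  set R : EuclideanSpace ℝ (Fin p) → (EuclideanSpace ℝ (Fin p) →L[ℝ] EuclideanSpace ℝ (Fin p)) :=
    fun x => InnerProductSpace.rankOne ℝ x x with hR
  have hRc : Continuous R := by
    have h1 : Continuous (InnerProductSpace.rankOne ℝ : EuclideanSpace ℝ (Fin p) →L[ℝ]
      EuclideanSpace ℝ (Fin p) →L⋆[ℝ] (EuclideanSpace ℝ (Fin p) →L[ℝ] EuclideanSpace ℝ (Fin p))) :=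
      ContinuousLinearMap.continuous _
    exact h1.clm_apply continuous_id
  have hint : Integrable (fun ω => R (X 0 ω)) P := by
    refine (hXL2.integrable_norm_pow two_ne_zero).mono'
      (hRc.comp_aestronglyMeasurable hXL2.1) (Eventually.of_forall fun ω => ?_)
    simp [hR, pow_two]
  -- Strong law in the space of operators; the norm of `R x` is `‖x‖ ^ 2`, so second moments give
  -- integrability.
  have h := strong_law_ae (fun i ω => R (X i ω)) hint
    (fun i j hij => (hXindep.indepFun hij).comp hRc.measurable hRc.measurable)
    (fun i => (hXident i).comp hRc.measurable)
  have hlim : ∫ ω, R (X 0 ω) ∂P = Matrix.toEuclideanCLM (𝕜 := ℝ) C := by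
    ext1 u
    refine ext_inner_left ℝ fun v => ?_
    rw [← integral_inner_mul_inner hXL2 hXmean hXcov, ContinuousLinearMap.integral_apply hint,
      ← integral_inner (hint.apply_continuousLinearMap u)]
    refine integral_congr_ae (Eventually.of_forall fun ω => ?_)
    simp only [hR, InnerProductSpace.rankOne_apply, inner_smul_right]
    rw [real_inner_comm (X 0 ω) v]
  rw [hlim] at h
  exact h

/-- The normalized score is asymptotically Gaussian. -/
theorem tendstoInDistribution_score {Ω' : Type*} [MeasurableSpace Ω'] {P' : Measure Ω'}
    [IsProbabilityMeasure P'] (hC : C.PosDef) {X : ℕ → Ω → EuclideanSpace ℝ (Fin p)}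
    (hXmeas : ∀ i, Measurable (X i)) (hXindep : iIndepFun X P)
    (hXident : ∀ i, IdentDistrib (X i) (X 0) P P)
    (hXL2 : MemLp (X 0) 2 P) (hXmean : ∫ ω, X 0 ω ∂P = 0)
    (hXcov : ∀ j k, cov[fun ω => X 0 ω j, fun ω => X 0 ω k; P] = C j k)
    {ε : ℕ → Ω → ℝ} {σ : ℝ}
    (hεmeas : ∀ i, Measurable (ε i)) (hεindep : iIndepFun ε P)
    (hεident : ∀ i, IdentDistrib (ε i) (ε 0) P P)
    (hεL2 : MemLp (ε 0) 2 P) (hεmean : ∫ ω, ε 0 ω ∂P = 0)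
    (hεvar : Var[ε 0; P] = σ ^ 2)
    (hXε : IndepFun (fun ω i => X i ω) (fun ω i => ε i ω) P)
    {W : Ω' → EuclideanSpace ℝ (Fin p)} (hW : HasLaw W (multivariateGaussian 0 (σ ^ 2 • C)) P') :
    TendstoInDistribution (fun n ω => score n (fun i => X i ω) fun i => ε i ω) atTop W
      (fun _ => P) P' where
  forall_aemeasurable n := by
    refine Measurable.aemeasurable ?_
    unfold score
    fun_prop
  aemeasurable_limit := hW.aemeasurable
  tendsto := by
    have hmeas : ∀ n, Measurable fun ω => score n (fun i => X i ω) fun i => ε i ω := fun n => by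
      unfold score
      fun_prop
    have hind : ∀ i, IndepFun (X i) (ε i) P := fun i =>
      hXε.comp (measurable_pi_apply i) (measurable_pi_apply i)
    refine ProbabilityMeasure.tendsto_iff_tendsto_charFun.2 fun t => ?_
    -- Cramér–Wold: the characteristic function of the score at `t` is that of the normalized sum of
    -- the scalars `φ (X i, ε i)` at `1`, to which the one-dimensional central limit theorem
    -- applies.
    set φ : EuclideanSpace ℝ (Fin p) × ℝ → ℝ := fun q => inner ℝ q.1 t * q.2 with hφ
    have hφm : Measurable φ := by fun_prop
    have hYindep : iIndepFun (fun i ω => φ (X i ω, ε i ω)) P :=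
      (iIndepFun_prodMk hXmeas hεmeas hXindep hεindep hXε).comp (fun _ => φ) fun _ => hφm
    have hYident : ∀ i, IdentDistrib (fun ω => φ (X i ω, ε i ω)) (fun ω => φ (X 0 ω, ε 0 ω)) P P :=
      fun i => ((hXident i).prodMk (hεident i) (hind i) (hind 0)).comp hφm
    have hXt : MemLp (fun ω => inner ℝ (X 0 ω) t) 2 P := memLp_inner hXL2 t
    have hindt : IndepFun (fun ω => inner ℝ (X 0 ω) t) (ε 0) P :=
      (hind 0).comp (φ := fun x => inner ℝ x t) (by fun_prop) measurable_id
    have hYsq : ∀ ω, φ (X 0 ω, ε 0 ω) ^ 2 = (inner ℝ (X 0 ω) t) ^ 2 * ε 0 ω ^ 2 := fun ω =>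
      mul_pow _ _ _
    have hindsq : IndepFun (fun ω => (inner ℝ (X 0 ω) t) ^ 2) (fun ω => ε 0 ω ^ 2) P :=
      hindt.comp (φ := fun x => x ^ 2) (ψ := fun x => x ^ 2) (by fun_prop) (by fun_prop)
    have hYL2 : MemLp (fun ω => φ (X 0 ω, ε 0 ω)) 2 P := by
      refine (memLp_two_iff_integrable_sq
        (hφm.comp ((hXmeas 0).prodMk (hεmeas 0))).aestronglyMeasurable).2 ?_
      exact (hindsq.integrable_mul hXt.integrable_sq hεL2.integrable_sq).congr
        (Eventually.of_forall fun ω => (hYsq ω).symm)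
    have hYmean : ∫ ω, φ (X 0 ω, ε 0 ω) ∂P = 0 := by
      have := hindt.integral_fun_mul_eq_mul_integral hXt.1 hεL2.1
      rw [hεmean, mul_zero] at this
      exact this
    have hεsq : ∫ ω, ε 0 ω ^ 2 ∂P = σ ^ 2 := by
      rw [← hεvar, variance_of_integral_eq_zero (hεmeas 0).aemeasurable hεmean]
    have hYvar : Var[fun ω => φ (X 0 ω, ε 0 ω); P] =
        σ ^ 2 * inner ℝ t (Matrix.toEuclideanCLM (𝕜 := ℝ) C t) := by
      rw [variance_of_integral_eq_zero (X := fun ω => φ (X 0 ω, ε 0 ω))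
        (hφm.comp ((hXmeas 0).prodMk (hεmeas 0))).aemeasurable hYmean]
      simp_rw [hYsq]
      rw [hindsq.integral_fun_mul_eq_mul_integral (hXt.integrable_sq).1 (hεL2.integrable_sq).1,
        hεsq, ← integral_inner_mul_inner hXL2 hXmean hXcov, mul_comm]
      simp_rw [pow_two]
    have hclt := tendstoInDistribution_inv_sqrt_mul_sum_sub (P' := gaussianReal 0 _)
      (HasLaw.id) hYL2 hYindep hYident
    simp only [hYmean, mul_zero, sub_zero] at hclt
    have hlim := ProbabilityMeasure.tendsto_iff_tendsto_charFun.1 hclt.tendsto 1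
    have hpsd : (σ ^ 2 • C).PosSemidef := hC.posSemidef.smul (sq_nonneg σ)
    convert hlim using 1
    · funext n
      have hm2 : Measurable fun ω => (√(n : ℝ))⁻¹ *
          ∑ k ∈ Finset.range n, φ (X k ω, ε k ω) := by
        fun_prop
      simp only [ProbabilityMeasure.coe_mk]
      rw [charFun_apply, charFun_apply, integral_map (hmeas n).aemeasurable (by fun_prop),
        integral_map hm2.aemeasurable (by fun_prop)]
      refine integral_congr_ae (Eventually.of_forall fun ω => ?_)
      simp only [score, inner_smul_left, sum_inner, hφ]
      simp [mul_comm]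
    · simp only [ProbabilityMeasure.coe_mk]
      rw [hW.map_eq, charFun_multivariateGaussian hpsd, Measure.map_id, charFun_gaussianReal, hYvar,
        Matrix.inner_toEuclideanCLM]
      have : 0 ≤ σ ^ 2 * (t.ofLp ⬝ᵥ C.mulVec t.ofLp) := by
        rw [← Matrix.inner_toEuclideanCLM, ← hYvar]
        exact variance_nonneg _ _
      rw [Real.coe_toNNReal _ this]
      simp [Matrix.smul_mulVec, dotProduct_smul]

/-- Hyperplanes are null sets of a nondegenerate Gaussian. -/
theorem ae_inner_ne {Ω' : Type*} [MeasurableSpace Ω'] {P' : Measure Ω'}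
    {S : Matrix (Fin p) (Fin p) ℝ} (hS : S.PosDef)
    {W : Ω' → EuclideanSpace ℝ (Fin p)} (hW : HasLaw W (multivariateGaussian 0 S) P')
    {z : EuclideanSpace ℝ (Fin p)} (hz : z ≠ 0) (c : ℝ) : ∀ᵐ ω ∂P', inner ℝ z (W ω) ≠ c := by
  have hlaw : (multivariateGaussian 0 S).map (innerSL ℝ z) =
      gaussianReal ((multivariateGaussian 0 S)[innerSL ℝ z])
        Var[innerSL ℝ z; multivariateGaussian 0 S].toNNReal :=
    IsGaussian.map_eq_gaussianReal _
  have hvar : Var[innerSL ℝ z; multivariateGaussian 0 S] = z.ofLp ⬝ᵥ S.mulVec z.ofLp := by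
    rw [← covarianceBilin_multivariateGaussian hS.posSemidef (μ := 0),
      covarianceBilin_self IsGaussian.memLp_two_id]
    rfl
  have hpos : 0 < z.ofLp ⬝ᵥ S.mulVec z.ofLp := by
    have := hS.dotProduct_mulVec_pos (x := z.ofLp) (by simpa using hz)
    simpa using this
  -- The projection onto `z` is a real Gaussian of variance `zᵀ S z > 0`, hence has no atoms.
  have hna : NullSingletonClass ((multivariateGaussian 0 S).map (innerSL ℝ z)) := by
    rw [hlaw]
    refine nullSingletonClass_gaussianReal ?_
    rw [hvar]
    simpa using hpos
  have h1 : ∀ᵐ x ∂(P'.map W), inner ℝ z x ≠ c := by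
    rw [hW.map_eq]
    have h2 : ∀ᵐ y ∂((multivariateGaussian 0 S).map (innerSL ℝ z)), y ≠ c :=
      measure_eq_zero_iff_ae_notMem.1 (measure_singleton c)
    exact ae_of_ae_map (p := fun y => y ≠ c) (innerSL ℝ z).continuous.aemeasurable h2
  exact ae_of_ae_map hW.aemeasurable h1

end SLOPE

/-! ### Assembly by the portmanteau theorem. -/

theorem mainTheorem7
    {Ω : Type*} [MeasurableSpace Ω] (P : Measure Ω) [IsProbabilityMeasure P]
    {Ω' : Type*} [MeasurableSpace Ω'] (P' : Measure Ω') [IsProbabilityMeasure P']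
    (p : ℕ) (β₀ : EuclideanSpace ℝ (Fin p))
    -- i.i.d. centered regressors with positive definite covariance matrix `C`
    (X : ℕ → Ω → EuclideanSpace ℝ (Fin p)) (C : Matrix (Fin p) (Fin p) ℝ)
    (hXmeas : ∀ i, Measurable (X i)) (hXindep : iIndepFun X P)
    (hXident : ∀ i, IdentDistrib (X i) (X 0) P P)
    (hXL2 : MemLp (X 0) 2 P) (hXmean : ∫ ω, X 0 ω ∂P = 0)
    (hXcov : ∀ j k, cov[fun ω => X 0 ω j, fun ω => X 0 ω k; P] = C j k)
    (hC : C.PosDef)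
    -- i.i.d. centered noise with variance `σ² > 0`, independent of the regressors
    (ε : ℕ → Ω → ℝ) (σ : ℝ) (hσ : 0 < σ)
    (hεmeas : ∀ i, Measurable (ε i)) (hεindep : iIndepFun ε P)
    (hεident : ∀ i, IdentDistrib (ε i) (ε 0) P P)
    (hεL2 : MemLp (ε 0) 2 P) (hεmean : ∫ ω, ε 0 ω ∂P = 0)
    (hεvar : Var[ε 0; P] = σ ^ 2)
    (hXε : IndepFun (fun ω i => X i ω) (fun ω i => ε i ω) P)
    -- penalty sequences with `lam n / √n → lam₀`
    (lam : ℕ → Fin p → ℝ) (lam₀ : Fin p → ℝ)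
    (hlam_anti : ∀ n, Antitone (lam n)) (hlam_nonneg : ∀ n i, 0 ≤ lam n i)
    (hlam : Tendsto (fun (n : ℕ) (i : Fin p) => lam n i / √(n : ℝ)) atTop (𝓝 lam₀))
    -- SLOPE estimator: minimizer of the SLOPE objective for `y = X β₀ + ε`
    (βhat : ℕ → Ω → EuclideanSpace ℝ (Fin p)) (hβmeas : ∀ n, AEMeasurable (βhat n) P)
    (hβ : ∀ n, ∀ᵐ ω ∂P, ∀ b : EuclideanSpace ℝ (Fin p),
      SLOPE.objective n (fun i => X i ω) (fun i => inner ℝ (X i ω) β₀ + ε i ω) (lam n) (βhat n ω)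
        ≤ SLOPE.objective n (fun i => X i ω) (fun i => inner ℝ (X i ω) β₀ + ε i ω) (lam n) b)
    -- limiting variable: minimizer of `V` with `W ∼ N(0, σ² C)`
    (W : Ω' → EuclideanSpace ℝ (Fin p)) (hW : HasLaw W (multivariateGaussian 0 (σ ^ 2 • C)) P')
    (uhat : Ω' → EuclideanSpace ℝ (Fin p))
    (hu : ∀ᵐ ω ∂P', ∀ v : EuclideanSpace ℝ (Fin p),
      SLOPE.limitObjective C lam₀ β₀ (W ω) (uhat ω) ≤ SLOPE.limitObjective C lam₀ β₀ (W ω) v)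
    (𝔭 : Fin p → ℤ) (h𝔭 : 𝔭 ∈ Set.range (SLOPE.patt (p := p))) :
    Tendsto (fun n => P {ω | SLOPE.patt (βhat n ω) = 𝔭}) atTop
      (𝓝 (P' {ω | SLOPE.limitPatt β₀ (uhat ω) = 𝔭})) := by
  have hSpd : (σ ^ 2 • C).PosDef := hC.smul (by positivity)
  set A := Matrix.toEuclideanCLM (𝕜 := ℝ) C with hAdef
  have hquad : ∀ x y : EuclideanSpace ℝ (Fin p),
      inner ℝ (A x) y = y.ofLp ⬝ᵥ C.mulVec x.ofLp := fun x y => by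
    rw [real_inner_comm, hAdef, Matrix.inner_toEuclideanCLM]
  have hsymm : ∀ x y, inner ℝ (A x) y = inner ℝ (A y) x := fun x y => by
    have hT : C.transpose = C := by simpa using hC.isHermitian.eq
    rw [hquad, hquad, Matrix.dotProduct_mulVec, ← Matrix.mulVec_transpose, hT, dotProduct_comm]
  have hA : ∀ v, v ≠ 0 → 0 < inner ℝ (A v) v := fun v hv => by
    rw [hquad]
    simpa using hC.dotProduct_mulVec_pos (x := v.ofLp) (by simpa using hv)
  have hlim_apply : ∀ i, Tendsto (fun n : ℕ => lam n i / √(n : ℝ)) atTop (𝓝 (lam₀ i)) :=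
    tendsto_pi_nhds.1 hlam
  have ha₀ : Antitone lam₀ := fun i j hij =>
    le_of_tendsto_of_tendsto' (hlim_apply j) (hlim_apply i) fun n =>
      div_le_div_of_nonneg_right (hlam_anti n hij) (Real.sqrt_nonneg _)
  have h0₀ : ∀ i, 0 ≤ lam₀ i := fun i =>
    ge_of_tendsto' (hlim_apply i) fun n => div_nonneg (hlam_nonneg n i) (Real.sqrt_nonneg _)
  -- joint convergence of the rescaled data
  set Z : ℕ → Ω → (EuclideanSpace ℝ (Fin p) →L[ℝ] EuclideanSpace ℝ (Fin p)) ×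
      EuclideanSpace ℝ (Fin p) × (Fin p → ℝ) × ℝ := fun n ω =>
    (SLOPE.empCov n fun i => X i ω, SLOPE.score n (fun i => X i ω) fun i => ε i ω,
      (fun i => lam n i / √(n : ℝ)), (√(n : ℝ))⁻¹) with hZ
  have : ProperSpace (EuclideanSpace ℝ (Fin p) →L[ℝ] EuclideanSpace ℝ (Fin p)) :=
    FiniteDimensional.proper ℝ _
  have hempmeas : ∀ n, Measurable fun ω => SLOPE.empCov n fun i => X i ω := fun n => by
    have h1 : Continuous fun x : EuclideanSpace ℝ (Fin p) => InnerProductSpace.rankOne ℝ x x :=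
      (ContinuousLinearMap.continuous (InnerProductSpace.rankOne ℝ :
        EuclideanSpace ℝ (Fin p) →L[ℝ] EuclideanSpace ℝ (Fin p) →L⋆[ℝ]
          (EuclideanSpace ℝ (Fin p) →L[ℝ] EuclideanSpace ℝ (Fin p)))).clm_apply continuous_id
    unfold SLOPE.empCov
    exact Measurable.const_smul
      (Finset.measurable_fun_sum _ fun i _ => h1.measurable.comp (hXmeas i)) (n : ℝ)⁻¹
  have hinv : Tendsto (fun n : ℕ => (√(n : ℝ))⁻¹) atTop (𝓝 0) :=
    tendsto_inv_atTop_zero.comp (Real.tendsto_sqrt_atTop.comp tendsto_natCast_atTop_atTop)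
  have hZlim : TendstoInDistribution Z atTop (fun ω => (A, W ω, lam₀, (0 : ℝ))) (fun _ => P) P' := by
    have hY : ∀ n, Measurable fun ω : Ω => ((SLOPE.empCov n fun i => X i ω),
        (fun i => lam n i / √(n : ℝ)), (√(n : ℝ))⁻¹) := fun n =>
      (hempmeas n).prodMk measurable_const
    -- Slutsky: only the score has a random limit; `g` merely reorders the components.
    refine TendstoInDistribution.continuous_comp_prodMk_of_tendstoInMeasure_const
      (g := fun q : EuclideanSpace ℝ (Fin p) ×
        ((EuclideanSpace ℝ (Fin p) →L[ℝ] EuclideanSpace ℝ (Fin p)) × (Fin p → ℝ) × ℝ) =>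
        (q.2.1, q.1, q.2.2.1, q.2.2.2)) (by fun_prop)
      (SLOPE.tendstoInDistribution_score hC hXmeas hXindep hXident hXL2 hXmean hXcov hεmeas hεindep
        hεident hεL2 hεmean hεvar hXε hW)
      (Y := fun n ω => ((SLOPE.empCov n fun i => X i ω),
        (fun i => lam n i / √(n : ℝ)), (√(n : ℝ))⁻¹)) (c := (A, lam₀, (0 : ℝ)))
      (tendstoInMeasure_of_tendsto_ae (fun n => (hY n).aestronglyMeasurable) ?_)
      fun n => (hY n).aemeasurable
    filter_upwards [SLOPE.ae_tendsto_empCov hXindep hXident hXL2 hXmean hXcov] with ω hω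
    exact hω.prodMk_nhds (hlam.prodMk_nhds hinv)
  have hZmeas : ∀ n, AEMeasurable (Z n) P := hZlim.forall_aemeasurable
  -- the limit lies in the stable region
  have hstable : ∀ᵐ ω ∂P', SLOPE.patternSolvable β₀ (SLOPE.limitPatt β₀ (uhat ω)) ∈
      𝓝 (A, W ω, lam₀, (0 : ℝ)) := by
    have hdeg : ∀ᵐ ω ∂P', ∀ π s r τ, SLOPE.signVec τ ∉ SLOPE.patternSpace s r →
        W ω ∉ SLOPE.degenerateSet A lam₀ π s r τ := by
      refine ae_all_iff.2 fun π => ae_all_iff.2 fun s => ae_all_iff.2 fun r =>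
        ae_all_iff.2 fun τ => ?_
      by_cases hτ : SLOPE.signVec τ ∈ SLOPE.patternSpace s r
      · exact Eventually.of_forall fun ω h => absurd hτ h
      obtain ⟨z, hz, c, hsub⟩ := SLOPE.degenerateSet_subset_hyperplane hsymm hA lam₀ π hτ
      filter_upwards [SLOPE.ae_inner_ne hSpd hW hz c] with ω hω _ hmem
      exact hω (hsub hmem)
    filter_upwards [hu, hdeg] with ω h1 h2
    refine SLOPE.patternSolvable_mem_nhds hsymm hA ha₀ h0₀ (fun v => ?_) h2
    have h3 : ∀ u : EuclideanSpace ℝ (Fin p), inner ℝ u (W ω) = u.ofLp ⬝ᵥ (W ω).ofLp := fun u => by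
      rw [EuclideanSpace.inner_eq_star_dotProduct, star_trivial, dotProduct_comm]
    rw [hquad, hquad, h3, h3]
    exact h1 v
  -- Sets `Q` of patterns are allowed so that the same lower bound serves `{𝔭}` and `{𝔭}ᶜ`.
  set O : Set (Fin p → ℤ) → Set ((EuclideanSpace ℝ (Fin p) →L[ℝ] EuclideanSpace ℝ (Fin p)) ×
      EuclideanSpace ℝ (Fin p) × (Fin p → ℝ) × ℝ) :=
    fun Q => ⋃ q ∈ Q, interior (SLOPE.patternSolvable β₀ q) with hO
  have hOopen : ∀ Q, IsOpen (O Q) := fun Q => isOpen_biUnion fun q _ => isOpen_interior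
  have hlower : ∀ Q, P' {ω | SLOPE.limitPatt β₀ (uhat ω) ∈ Q} ≤
      liminf (fun n => P {ω | Z n ω ∈ O Q}) atTop := fun Q => by
    have h1 := ProbabilityMeasure.le_liminf_measure_open_of_tendsto hZlim.tendsto (hOopen Q)
    simp only [ProbabilityMeasure.coe_mk] at h1
    rw [Measure.map_apply_of_aemeasurable hZlim.aemeasurable_limit (hOopen Q).measurableSet] at h1
    simp_rw [fun n => Measure.map_apply_of_aemeasurable (hZmeas n) (hOopen Q).measurableSet] at h1
    refine le_trans (measure_mono_ae ?_) h1
    filter_upwards [hstable] with ω hω hQ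
    exact Set.mem_biUnion hQ (mem_interior_iff_mem_nhds.2 hω)
  have hpatt : ∀ Q, ∀ n, 0 < n → ∀ᵐ ω ∂P, Z n ω ∈ O Q → SLOPE.patt (βhat n ω) ∈ Q :=
    fun Q n hn => by
      filter_upwards [hβ n] with ω hω hmem
      obtain ⟨q, hq, hmem⟩ := Set.mem_iUnion₂.1 hmem
      rw [SLOPE.patt_eq_of_patternSolvable hn (hlam_anti n) (hlam_nonneg n)
        (interior_subset hmem) hω]
      exact hq
  refine tendsto_of_le_liminf_of_limsup_le ?_ ?_
  · refine (hlower {𝔭}).trans (liminf_le_liminf ?_)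
    filter_upwards [eventually_gt_atTop 0] with n hn
    exact measure_mono_ae (hpatt {𝔭} n hn)
  -- Upper bound from the lower bound for the complementary patterns. Subadditivity at the end
  -- spares any measurability of the events defined through `uhat`.
  · have h1 : ∀ᶠ n in atTop, P {ω | SLOPE.patt (βhat n ω) = 𝔭} ≤
        1 - P {ω | Z n ω ∈ O {𝔭}ᶜ} := by
      filter_upwards [eventually_gt_atTop 0] with n hn
      have hnull : NullMeasurableSet {ω | Z n ω ∈ O {𝔭}ᶜ} P :=
        (hZmeas n).nullMeasurableSet_preimage (hOopen _).measurableSet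
      rw [← prob_compl_eq_one_sub₀ hnull]
      refine measure_mono_ae ?_
      filter_upwards [hpatt {𝔭}ᶜ n hn] with ω hω h2 h3
      exact hω h3 h2
    refine (limsup_le_limsup h1).trans ?_
    rw [ENNReal.limsup_const_sub _ _ ENNReal.one_ne_top]
    refine (tsub_le_tsub_left (hlower {𝔭}ᶜ) 1).trans ?_
    rw [tsub_le_iff_right]
    have h2 : (Set.univ : Set Ω') = {ω | SLOPE.limitPatt β₀ (uhat ω) = 𝔭} ∪
        {ω | SLOPE.limitPatt β₀ (uhat ω) ∈ ({𝔭}ᶜ : Set (Fin p → ℤ))} := by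
      ext ω
      simpa using em _
    rw [← measure_univ (μ := P'), h2]
    exact measure_union_le _ _
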